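/- **Programs.** Fix a countably infinite set $\mathsf{Var}$ of variables. Probabilistic programs are given by the grammar $$P ::= v := e \;\mid\; P;P \;\mid\; \{P\}\,[p]\,\{P\} \;\mid\; \mathtt{WHILE}\,(b)\,\{P\},$$ where $v \in \mathsf{Var}$, $e$ is an arithmetical expression (built from variables and rational constants by $+,-,\cdot$), $p \in [0,1]$ is rational, and $b$ is a Boolean expression (built from comparisons $e_1 = e_2$, $e_1 < e_2$ of arithmetical expressions by $\neg,\wedge,\vee$). Rational constants are written as fractions of numerals. Programs are identified with their codes under a standard effective numbering, so that one can speak of decidable sets of programs and of computable functions into the set $\mathsf{Prog}$ of programs. **Semantics.** A valuation (input) is a map $\eta : \mathsf{Var} \to \mathbb{Q}_{\ge 0}$. A state $\langle c, \eta, a, \theta\rangle$ consists of the remaining program $c$ (or $\downarrow$, if nothing remains), a valuation, a rational $a$ (the probability of the choices made so far) and a word $\theta \in \{L,R\}^*$ (these choices). The one-step relation $\vdash$ is the smallest relation with * $\langle v := e, \eta, a, \theta\rangle \vdash \langle \downarrow, \eta[v \mapsto \max\{[\![e]\!]_\eta, 0\}], a, \theta\rangle$; * $\langle P_1;P_2,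 \eta, a, \theta\rangle \vdash \langle P_1';P_2, \eta', a', \theta'\rangle$ whenever $\langle P_1, \eta, a, \theta\rangle \vdash \langle P_1', \eta', a', \theta'\rangle$ (where $P_1'$ may be $\downarrow$), and $\langle \downarrow;P_2, \eta, a, \theta\rangle \vdash \langle P_2, \eta, a, \theta\rangle$; * $\langle \{P_1\}[p]\{P_2\}, \eta, a, \theta\rangle \vdash \langle P_1, \eta, a p, \theta L\rangle$ and $\langle \{P_1\}[p]\{P_2\}, \eta, a, \theta\rangle \vdash \langle P_2, \eta, a(1-p), \theta R\rangle$; * $\langle \mathtt{WHILE}(b)\{P\}, \eta, a, \theta\rangle \vdash \langle P;\mathtt{WHILE}(b)\{P\}, \eta, a, \theta\rangle$ if $[\![b]\!]_\eta$ is true, and $\vdash \langle \downarrow, \eta, a, \theta\rangle$ if $[\![b]\!]_\eta$ is false. Let $\sigma_{P,\eta} = \langle P, \eta, 1, \varepsilon\rangle$. For $k \in \mathbb{N}$ and $w \in \{L,R\}^*$ let $T_k(\sigma, w)$ be the unique state that is reached from $\sigma$ by exactly $k$ steps in which exactly the choices $w$ are made, and $\bot$ if there is none. Let $\alpha(\sigma)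 = a$ if $\sigma = \langle \downarrow, \eta, a, \theta\rangle$ is terminal, and $\alpha(\sigma) = 0$ for all other states and for $\sigma = \bot$. The expected time until termination of $P$ on $\eta$ is $$\mathrm{E}_{P,\eta}(\downarrow) = \sum_{k=0}^{\infty}\Bigl(1 - \sum_{j=0}^{k}\ \sum_{w \in \{L,R\}^{\le j}} \alpha\bigl(T_j(\sigma_{P,\eta}, w)\bigr)\Bigr) \in [0,\infty],$$ that is, $\sum_k \Pr(P \text{ does not terminate on } \eta \text{ within } k \text{ steps})$. Universal positive almost-sure termination is the set $$\mathcal{UPAST} = \{P \in \mathsf{Prog} \mid \mathrm{E}_{P,\eta}(\downarrow) < \infty \text{ for every valuation } \eta\}.$$ **Arithmetical hierarchy.** A set $A$ is in $\Pi^0_3$ if there is a decidable relation $R$ such that $x \in A \Leftrightarrow \forall y_1\, \exists y_2\, \forall y_3\; R(x,y_1,y_2,y_3)$ for all $x$, where the $y_i$ range over $\mathbb{N}$. It is $\Pi^0_3$-hard if every $\Pi^0_3$ set $C$ is many-one reducible to $A$, i.e. there is a computable total function $f$ with $x \in C \Leftrightarrow f(x) \in A$ for all $x$; it is $\Pi^0_3$-complete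 if it is in $\Pi^0_3$ and $\Pi^0_3$-hard. **Theorem.** $\mathcal{UPAST}$ is $\Pi^0_3$-complete. -/

import Mathlib

open scoped ENNReal

namespace PGCL

/-! Syntax. -/

/-- The program variables: countably many, named by natural numbers. -/
abbrev Var : Type := ℕ

/-- Arithmetical expressions over `Var`. Rational constants are written as fractions of numerals:
`const n d` denotes `n / (d + 1)`. -/
inductive AExp : Type
  | const (n d : ℕ) : AExp
  | var (v : Var) : AExp
  | add (e₁ e₂ : AExp) : AExp
  | sub (e₁ e₂ : AExp) : AExp
  | mul (e₁ e₂ : AExp) : AExp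

/-- Boolean expressions over arithmetical expressions. -/
inductive BExp : Type
  | eq (e₁ e₂ : AExp) : BExp
  | lt (e₁ e₂ : AExp) : BExp
  | not (b : BExp) : BExp
  | and (b₁ b₂ : BExp) : BExp
  | or (b₁ b₂ : BExp) : BExp

/-- A rational number in `[0, 1]`, written as a fraction. -/
@[ext] structure UnitFrac : Type where
  num : ℕ
  den : ℕ
  den_pos : 0 < den
  num_le : num ≤ den

/-- The rational number that a fraction denotes. -/
def UnitFrac.val (p : UnitFrac) : ℚ := (p.num : ℚ) / (p.den : ℚ)

/-- Probabilistic programs: assignment `v := e`, concatenation `P₁; P₂`, probabilistic choice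
`{P₁} [p] {P₂}` and the loop `WHILE (b) {P}`. -/
inductive Prog : Type
  | assign (v : Var) (e : AExp) : Prog
  | seq (P₁ P₂ : Prog) : Prog
  | choice (p : UnitFrac) (P₁ P₂ : Prog) : Prog
  | loop (b : BExp) (P : Prog) : Prog

/-! The effective numberings of the syntactic categories: explicit bijections with `ℕ`, used to
speak of decidable sets of programs and of computable functions into programs. -/

/-- The code of an arithmetical expression. -/
def AExp.toNat : AExp → ℕ
  | const n d => 5 * Nat.pair n d
  | var v => 5 * v + 1
  | add e₁ e₂ => 5 * Nat.pair e₁.toNat e₂.toNat + 2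
  | sub e₁ e₂ => 5 * Nat.pair e₁.toNat e₂.toNat + 3
  | mul e₁ e₂ => 5 * Nat.pair e₁.toNat e₂.toNat + 4

/-- The arithmetical expression with a given code. -/
def AExp.ofNat (n : ℕ) : AExp :=
  if n % 5 = 0 then const (n / 5).unpair.1 (n / 5).unpair.2
  else if n % 5 = 1 then var (n / 5)
  else if h : n = 0 then var 0
  else
    have h₁ : (n / 5).unpair.1 < n :=
      lt_of_le_of_lt (Nat.unpair_left_le _) (Nat.div_lt_self (Nat.pos_of_ne_zero h) (by norm_num))
    have h₂ : (n / 5).unpair.2 < n :=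
      lt_of_le_of_lt (Nat.unpair_right_le _) (Nat.div_lt_self (Nat.pos_of_ne_zero h) (by norm_num))
    if n % 5 = 2 then add (AExp.ofNat (n / 5).unpair.1) (AExp.ofNat (n / 5).unpair.2)
    else if n % 5 = 3 then sub (AExp.ofNat (n / 5).unpair.1) (AExp.ofNat (n / 5).unpair.2)
    else mul (AExp.ofNat (n / 5).unpair.1) (AExp.ofNat (n / 5).unpair.2)
termination_by n

theorem AExp.ofNat_toNat (e : AExp) : AExp.ofNat e.toNat = e := by
  induction e with
  | const n d => rw [AExp.ofNat]; simp [AExp.toNat]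
  | var v =>
    have hm : ∀ m : ℕ, (5 * m + 1) % 5 = 1 := by omega
    have hd : ∀ m : ℕ, (5 * m + 1) / 5 = m := by omega
    rw [AExp.ofNat]
    simp [AExp.toNat, hm, hd]
  | add a b iha ihb =>
    have hm : ∀ m : ℕ, (5 * m + 2) % 5 = 2 := by omega
    have hd : ∀ m : ℕ, (5 * m + 2) / 5 = m := by omega
    rw [AExp.ofNat]
    simp [AExp.toNat, hm, hd, iha, ihb]
  | sub a b iha ihb =>
    have hm : ∀ m : ℕ, (5 * m + 3) % 5 = 3 := by omega
    have hd : ∀ m : ℕ, (5 * m + 3) / 5 = m := by omega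
    rw [AExp.ofNat]
    simp [AExp.toNat, hm, hd, iha, ihb]
  | mul a b iha ihb =>
    have hm : ∀ m : ℕ, (5 * m + 4) % 5 = 4 := by omega
    have hd : ∀ m : ℕ, (5 * m + 4) / 5 = m := by omega
    rw [AExp.ofNat]
    simp [AExp.toNat, hm, hd, iha, ihb]

theorem AExp.toNat_ofNat (n : ℕ) : (AExp.ofNat n).toNat = n := by
  induction n using Nat.strong_induction_on with
  | _ n ih =>
    rw [AExp.ofNat]
    split_ifs with h0 h1 hz h2 h3
    · simp only [AExp.toNat, Nat.pair_unpair]; omega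
    · simp only [AExp.toNat]; omega
    · omega
    all_goals
      have a₁ := ih _ (lt_of_le_of_lt (Nat.unpair_left_le (n / 5)) (by omega))
      have a₂ := ih _ (lt_of_le_of_lt (Nat.unpair_right_le (n / 5)) (by omega))
      simp only [AExp.toNat, a₁, a₂, Nat.pair_unpair]
      omega

/-- The code of a Boolean expression. -/
def BExp.toNat : BExp → ℕ
  | eq e₁ e₂ => 5 * Nat.pair e₁.toNat e₂.toNat
  | lt e₁ e₂ => 5 * Nat.pair e₁.toNat e₂.toNat + 1
  | not b => 5 * b.toNat + 2
  | and b₁ b₂ => 5 * Nat.pair b₁.toNat b₂.toNat + 3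
  | or b₁ b₂ => 5 * Nat.pair b₁.toNat b₂.toNat + 4

/-- The Boolean expression with a given code. -/
def BExp.ofNat (n : ℕ) : BExp :=
  if n % 5 = 0 then eq (AExp.ofNat (n / 5).unpair.1) (AExp.ofNat (n / 5).unpair.2)
  else if n % 5 = 1 then lt (AExp.ofNat (n / 5).unpair.1) (AExp.ofNat (n / 5).unpair.2)
  else if h : n = 0 then eq (.var 0) (.var 0)
  else
    have h₀ : n / 5 < n := Nat.div_lt_self (Nat.pos_of_ne_zero h) (by norm_num)
    have h₁ : (n / 5).unpair.1 < n := lt_of_le_of_lt (Nat.unpair_left_le _) h₀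
    have h₂ : (n / 5).unpair.2 < n := lt_of_le_of_lt (Nat.unpair_right_le _) h₀
    if n % 5 = 2 then not (BExp.ofNat (n / 5))
    else if n % 5 = 3 then and (BExp.ofNat (n / 5).unpair.1) (BExp.ofNat (n / 5).unpair.2)
    else or (BExp.ofNat (n / 5).unpair.1) (BExp.ofNat (n / 5).unpair.2)
termination_by n

theorem BExp.ofNat_toNat (b : BExp) : BExp.ofNat b.toNat = b := by
  induction b with
  | eq a b => rw [BExp.ofNat]; simp [BExp.toNat, AExp.ofNat_toNat]
  | lt a b =>
    have hm : ∀ m : ℕ, (5 * m + 1) % 5 = 1 := by omega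
    have hd : ∀ m : ℕ, (5 * m + 1) / 5 = m := by omega
    rw [BExp.ofNat]
    simp [BExp.toNat, hm, hd, AExp.ofNat_toNat]
  | not b ih =>
    have hm : ∀ m : ℕ, (5 * m + 2) % 5 = 2 := by omega
    have hd : ∀ m : ℕ, (5 * m + 2) / 5 = m := by omega
    rw [BExp.ofNat]
    simp [BExp.toNat, hm, hd, ih]
  | and a b iha ihb =>
    have hm : ∀ m : ℕ, (5 * m + 3) % 5 = 3 := by omega
    have hd : ∀ m : ℕ, (5 * m + 3) / 5 = m := by omega
    rw [BExp.ofNat]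
    simp [BExp.toNat, hm, hd, iha, ihb]
  | or a b iha ihb =>
    have hm : ∀ m : ℕ, (5 * m + 4) % 5 = 4 := by omega
    have hd : ∀ m : ℕ, (5 * m + 4) / 5 = m := by omega
    rw [BExp.ofNat]
    simp [BExp.toNat, hm, hd, iha, ihb]

theorem BExp.toNat_ofNat (n : ℕ) : (BExp.ofNat n).toNat = n := by
  induction n using Nat.strong_induction_on with
  | _ n ih =>
    rw [BExp.ofNat]
    split_ifs with h0 h1 hz h2 h3
    · simp only [BExp.toNat, AExp.toNat_ofNat, Nat.pair_unpair]; omega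
    · simp only [BExp.toNat, AExp.toNat_ofNat, Nat.pair_unpair]; omega
    · omega
    all_goals
      have a₀ := ih (n / 5) (by omega)
      have a₁ := ih _ (lt_of_le_of_lt (Nat.unpair_left_le (n / 5)) (by omega))
      have a₂ := ih _ (lt_of_le_of_lt (Nat.unpair_right_le (n / 5)) (by omega))
      simp only [BExp.toNat, a₀, a₁, a₂, Nat.pair_unpair]
      omega

theorem Nat_pair_pos {a b : ℕ} (h : 0 < a + b) : 0 < Nat.pair a b := by
  have := Nat.add_le_pair a b
  omega

/-- The code of a fraction `num / den`: pairs `(num, den - num)` other than `(0, 0)` are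
numbered in the order of their code as pairs. -/
def UnitFrac.toNat (p : UnitFrac) : ℕ := Nat.pair p.num (p.den - p.num) - 1

/-- The fraction with a given code. -/
def UnitFrac.ofNat (n : ℕ) : UnitFrac where
  num := (n + 1).unpair.1
  den := (n + 1).unpair.1 + (n + 1).unpair.2
  den_pos := by
    by_contra h
    have h₁ : (n + 1).unpair.1 = 0 := by omega
    have h₂ : (n + 1).unpair.2 = 0 := by omega
    have h₃ := Nat.pair_unpair (n + 1)
    rw [h₁, h₂] at h₃
    simp [Nat.pair] at h₃
  num_le := Nat.le_add_right _ _

theorem UnitFrac.ofNat_toNat (p : UnitFrac) : UnitFrac.ofNat p.toNat = p := by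
  have hp := p.den_pos
  have hl := p.num_le
  have h : 0 < Nat.pair p.num (p.den - p.num) := Nat_pair_pos (by omega)
  ext
  · simp [UnitFrac.ofNat, UnitFrac.toNat, Nat.sub_add_cancel h]
  · simp only [UnitFrac.ofNat, UnitFrac.toNat, Nat.sub_add_cancel h, Nat.unpair_pair]
    omega

theorem UnitFrac.toNat_ofNat (n : ℕ) : (UnitFrac.ofNat n).toNat = n := by
  simp [UnitFrac.ofNat, UnitFrac.toNat]

/-- The code of a program. -/
def Prog.toNat : Prog → ℕ
  | assign v e => 4 * Nat.pair v e.toNat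
  | seq P₁ P₂ => 4 * Nat.pair P₁.toNat P₂.toNat + 1
  | choice p P₁ P₂ => 4 * Nat.pair p.toNat (Nat.pair P₁.toNat P₂.toNat) + 2
  | loop b P => 4 * Nat.pair b.toNat P.toNat + 3

/-- The program with a given code. -/
def Prog.ofNat (n : ℕ) : Prog :=
  if n % 4 = 0 then assign (n / 4).unpair.1 (AExp.ofNat (n / 4).unpair.2)
  else if h : n = 0 then assign 0 (.var 0)
  else
    have h₀ : n / 4 < n := Nat.div_lt_self (Nat.pos_of_ne_zero h) (by norm_num)
    have h₁ : (n / 4).unpair.1 < n := lt_of_le_of_lt (Nat.unpair_left_le _) h₀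
    have h₂ : (n / 4).unpair.2 < n := lt_of_le_of_lt (Nat.unpair_right_le _) h₀
    have h₃ : (n / 4).unpair.2.unpair.1 < n := lt_of_le_of_lt (Nat.unpair_left_le _) h₂
    have h₄ : (n / 4).unpair.2.unpair.2 < n := lt_of_le_of_lt (Nat.unpair_right_le _) h₂
    if n % 4 = 1 then seq (Prog.ofNat (n / 4).unpair.1) (Prog.ofNat (n / 4).unpair.2)
    else if n % 4 = 2 then
      choice (UnitFrac.ofNat (n / 4).unpair.1)
        (Prog.ofNat (n / 4).unpair.2.unpair.1) (Prog.ofNat (n / 4).unpair.2.unpair.2)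
    else loop (BExp.ofNat (n / 4).unpair.1) (Prog.ofNat (n / 4).unpair.2)
termination_by n

theorem Prog.ofNat_toNat (P : Prog) : Prog.ofNat P.toNat = P := by
  induction P with
  | assign v e => rw [Prog.ofNat]; simp [Prog.toNat, AExp.ofNat_toNat]
  | seq P Q ihP ihQ =>
    have hm : ∀ m : ℕ, (4 * m + 1) % 4 = 1 := by omega
    have hd : ∀ m : ℕ, (4 * m + 1) / 4 = m := by omega
    rw [Prog.ofNat]
    simp [Prog.toNat, hm, hd, ihP, ihQ]
  | choice p P Q ihP ihQ =>
    have hm : ∀ m : ℕ, (4 * m + 2) % 4 = 2 := by omega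
    have hd : ∀ m : ℕ, (4 * m + 2) / 4 = m := by omega
    rw [Prog.ofNat]
    simp [Prog.toNat, hm, hd, ihP, ihQ, UnitFrac.ofNat_toNat]
  | loop b P ih =>
    have hm : ∀ m : ℕ, (4 * m + 3) % 4 = 3 := by omega
    have hd : ∀ m : ℕ, (4 * m + 3) / 4 = m := by omega
    rw [Prog.ofNat]
    simp [Prog.toNat, hm, hd, ih, BExp.ofNat_toNat]

theorem Prog.toNat_ofNat (n : ℕ) : (Prog.ofNat n).toNat = n := by
  induction n using Nat.strong_induction_on with
  | _ n ih =>
    rw [Prog.ofNat]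
    split_ifs with h0 hz h1 h2
    · simp only [Prog.toNat, AExp.toNat_ofNat, Nat.pair_unpair]; omega
    · omega
    all_goals
      have b₂ := lt_of_le_of_lt (Nat.unpair_right_le (n / 4)) (show n / 4 < n by omega)
      have a₁ := ih _ (lt_of_le_of_lt (Nat.unpair_left_le (n / 4)) (by omega))
      have a₂ := ih _ b₂
      have a₃ := ih _ (lt_of_le_of_lt (Nat.unpair_left_le _) b₂)
      have a₄ := ih _ (lt_of_le_of_lt (Nat.unpair_right_le _) b₂)
      simp only [Prog.toNat, a₁, a₂, a₃, a₄, UnitFrac.toNat_ofNat, BExp.toNat_ofNat,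
        Nat.pair_unpair]
      omega

/-- Programs are in bijection with their codes. -/
def Prog.equivNat : Prog ≃ ℕ := ⟨Prog.toNat, Prog.ofNat, Prog.ofNat_toNat, Prog.toNat_ofNat⟩

instance : Denumerable Prog := Denumerable.mk' Prog.equivNat

instance : Primcodable Prog := Primcodable.ofDenumerable Prog

/-! Semantics. -/

/-- Variable valuations: every variable carries a nonnegative rational number. -/
abbrev Valuation : Type := Var → ℚ≥0

/-- The value of an arithmetical expression. -/
def AExp.eval (η : Valuation) : AExp → ℚ
  | const n d => (n : ℚ) / ((d : ℚ) + 1)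
  | var v => (η v : ℚ)
  | add e₁ e₂ => e₁.eval η + e₂.eval η
  | sub e₁ e₂ => e₁.eval η - e₂.eval η
  | mul e₁ e₂ => e₁.eval η * e₂.eval η

/-- The truth value of a Boolean expression. -/
def BExp.eval (η : Valuation) : BExp → Bool
  | eq e₁ e₂ => decide (e₁.eval η = e₂.eval η)
  | lt e₁ e₂ => decide (e₁.eval η < e₂.eval η)
  | not b => !b.eval η
  | and b₁ b₂ => b₁.eval η && b₂.eval η
  | or b₁ b₂ => b₁.eval η || b₂.eval η

/-- The resolution of a probabilistic choice: left or right. -/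
inductive Dir : Type
  | L : Dir
  | R : Dir
  deriving DecidableEq

instance : Fintype Dir := ⟨{Dir.L, Dir.R}, fun d => by cases d <;> simp⟩

/-- What remains to be executed: nothing (`↓`), a program, or a remainder `c` followed by a
program, `c; P`. The last form covers `↓; P`. -/
inductive Ctrl : Type
  | done : Ctrl
  | prog (P : Prog) : Ctrl
  | seq (c : Ctrl) (P : Prog) : Ctrl

/-- Program states `⟨c, η, a, θ⟩`: the remaining program, the current valuation, the probability
of the choices made so far, and the sequence of these choices. -/
@[ext] structure State : Type where
  ctrl : Ctrl
  val : Valuation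
  prob : ℚ
  hist : List Dir

/-- One inference step `σ ⊢ τ`. There are two versions of the rule for executing the first
component of a concatenation, for `P₁; P₂` as a program and for a remainder `c; P₂`. -/
inductive Step : State → State → Prop
  | assign (v : Var) (e : AExp) (η : Valuation) (a : ℚ) (θ : List Dir) :
      Step ⟨.prog (.assign v e), η, a, θ⟩
        ⟨.done, Function.update η v ⟨max (e.eval η) 0, le_max_right _ _⟩, a, θ⟩
  | concat1 (P₁ P₂ : Prog) (c' : Ctrl) (η η' : Valuation) (a a' : ℚ) (θ θ' : List Dir) :
      Step ⟨.prog P₁, η, a, θ⟩ ⟨c', η', a', θ'⟩ →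
      Step ⟨.prog (.seq P₁ P₂), η, a, θ⟩ ⟨.seq c' P₂, η', a', θ'⟩
  | concat1' (c : Ctrl) (P₂ : Prog) (c' : Ctrl) (η η' : Valuation) (a a' : ℚ) (θ θ' : List Dir) :
      Step ⟨c, η, a, θ⟩ ⟨c', η', a', θ'⟩ →
      Step ⟨.seq c P₂, η, a, θ⟩ ⟨.seq c' P₂, η', a', θ'⟩
  | concat2 (P₂ : Prog) (η : Valuation) (a : ℚ) (θ : List Dir) :
      Step ⟨.seq .done P₂, η, a, θ⟩ ⟨.prog P₂, η, a, θ⟩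
  | prob1 (p : UnitFrac) (P₁ P₂ : Prog) (η : Valuation) (a : ℚ) (θ : List Dir) :
      Step ⟨.prog (.choice p P₁ P₂), η, a, θ⟩ ⟨.prog P₁, η, a * p.val, θ ++ [Dir.L]⟩
  | prob2 (p : UnitFrac) (P₁ P₂ : Prog) (η : Valuation) (a : ℚ) (θ : List Dir) :
      Step ⟨.prog (.choice p P₁ P₂), η, a, θ⟩ ⟨.prog P₂, η, a * (1 - p.val), θ ++ [Dir.R]⟩
  | while1 (b : BExp) (P : Prog) (η : Valuation) (a : ℚ) (θ : List Dir) :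
      b.eval η = true →
      Step ⟨.prog (.loop b P), η, a, θ⟩ ⟨.prog (.seq P (.loop b P)), η, a, θ⟩
  | while2 (b : BExp) (P : Prog) (η : Valuation) (a : ℚ) (θ : List Dir) :
      b.eval η = false →
      Step ⟨.prog (.loop b P), η, a, θ⟩ ⟨.done, η, a, θ⟩

open Classical in
/-- The state successor function `T_k(σ, w)`: the state reached from `σ` by exactly `k` steps in
which exactly the choices `w` are made, and `none` if there is no such state. The successor used
in the recursion is unique, see `T_succ`. -/
noncomputable def T : ℕ → State → List Dir → Option State
  | 0, σ, w => if w = [] then some σ else none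
  | k + 1, σ, w =>
    if h : ∃ x : State × List Dir, ∃ b : List Dir,
        Step σ x.1 ∧ x.1.hist = σ.hist ++ b ∧ b.length ≤ 1 ∧ w = b ++ x.2
    then T k h.choose.1 h.choose.2 else none

theorem Step.hist_ext {σ τ : State} (h : Step σ τ) :
    ∃ b : List Dir, τ.hist = σ.hist ++ b ∧ b.length ≤ 1 := by
  induction h with
  | concat1 _ _ _ _ _ _ _ _ _ _ ih => exact ih
  | concat1' _ _ _ _ _ _ _ _ _ _ ih => exact ih
  | prob1 => exact ⟨[Dir.L], rfl, le_rfl⟩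
  | prob2 => exact ⟨[Dir.R], rfl, le_rfl⟩
  | _ => exact ⟨[], by simp, by simp⟩

theorem Step.det {σ τ τ' : State} (h : Step σ τ) (h' : Step σ τ') :
    τ.hist.length = τ'.hist.length ∧ (τ.hist = τ'.hist → τ = τ') := by
  induction h generalizing τ' with
  | concat1 _ _ _ _ _ _ _ _ _ _ ih =>
    cases h' with
    | concat1 _ _ _ _ _ _ _ _ _ h₂ =>
      obtain ⟨e₁, e₂⟩ := ih h₂
      refine ⟨e₁, fun e => ?_⟩
      have := e₂ e
      simp_all
  | concat1' _ _ _ _ _ _ _ _ _ h₁ ih =>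
    cases h' with
    | concat1' _ _ _ _ _ _ _ _ _ h₂ =>
      obtain ⟨e₁, e₂⟩ := ih h₂
      refine ⟨e₁, fun e => ?_⟩
      have := e₂ e
      simp_all
    | concat2 => cases h₁
  | concat2 =>
    cases h' with
    | concat1' _ _ _ _ _ _ _ _ _ h₂ => cases h₂
    | concat2 => simp
  | _ => cases h' <;> simp_all

/-- The recursion equation of the state successor function. -/
theorem T_succ {σ τ : State} {b : List Dir} (k : ℕ) (w : List Dir) (h : Step σ τ)
    (hb : τ.hist = σ.hist ++ b) : T (k + 1) σ (b ++ w) = T k τ w := by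
  have hex : ∃ x : State × List Dir, ∃ b' : List Dir,
      Step σ x.1 ∧ x.1.hist = σ.hist ++ b' ∧ b'.length ≤ 1 ∧ b ++ w = b' ++ x.2 := by
    obtain ⟨b', e, hl⟩ := h.hist_ext
    obtain rfl : b = b' := List.append_cancel_left (hb.symm.trans e)
    exact ⟨(τ, w), b, h, hb, hl, rfl⟩
  rw [T, dif_pos hex]
  obtain ⟨b', h', e', -, ew⟩ := hex.choose_spec
  obtain ⟨hl, hd⟩ := h.det h'
  have hlen : b.length = b'.length := by
    rw [hb, e'] at hl
    simpa using hl
  obtain ⟨rfl, ew'⟩ := List.append_inj ew hlen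
  rw [← hd (hb.trans e'.symm), ← ew']

/-- `α(σ)`: the probability `a` stored in a terminal state, and `0` for all other states and for
`none`. -/
def alpha : Option State → ℚ
  | some ⟨.done, _, a, _⟩ => a
  | _ => 0

/-- The initial state `σ_{P,η} = ⟨P, η, 1, ε⟩`. -/
def initState (P : Prog) (η : Valuation) : State := ⟨.prog P, η, 1, []⟩

/-- The probability that `P` terminates on `η` after exactly `k` steps, the sum of
`α(T_k(σ_{P,η}, w))` over all words `w` over `{L, R}` of length at most `k`. -/
noncomputable def termProbAt (P : Prog) (η : Valuation) (k : ℕ) : ℚ :=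
  ∑ i ∈ Finset.range (k + 1), ∑ w : Fin i → Dir, alpha (T k (initState P η) (List.ofFn w))

/-- The probability that `P` terminates on `η` within `k` steps. -/
noncomputable def termProbWithin (P : Prog) (η : Valuation) (k : ℕ) : ℚ :=
  ∑ j ∈ Finset.range (k + 1), termProbAt P η j

/-- The expected time until termination of `P` on `η`, the sum over all `k` of the probability
that `P` runs for more than `k` steps. -/
noncomputable def expectedTime (P : Prog) (η : Valuation) : ℝ≥0∞ :=
  ∑' k : ℕ, ENNReal.ofReal (1 - (termProbWithin P η k : ℝ))

/-- Positive almost-sure termination of `P` on `η`. -/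
def PAST (P : Prog) (η : Valuation) : Prop := expectedTime P η < ⊤

/-- The set of the universally positively almost-surely terminating programs. -/
def UPAST : Set Prog := {P | ∀ η : Valuation, PAST P η}

/-! The arithmetical hierarchy. -/

/-- `altQuant true n R` is `∃ y₁ ∀ y₂ ∃ y₃ ⋯ yₙ, R [y₁, …, yₙ]` and
`altQuant false n R` is `∀ y₁ ∃ y₂ ∀ y₃ ⋯ yₙ, R [y₁, …, yₙ]`. -/
def altQuant : Bool → ℕ → (List ℕ → Prop) → Prop
  | _, 0, R => R []
  | true, n + 1, R => ∃ y : ℕ, altQuant false n (fun ys => R (y :: ys))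
  | false, n + 1, R => ∀ y : ℕ, altQuant true n (fun ys => R (y :: ys))

/-- The class `Π⁰ₙ`. -/
def IsPi (n : ℕ) {X : Type} [Primcodable X] (A : Set X) : Prop :=
  ∃ R : X × List ℕ → Prop, ComputablePred R ∧
    ∀ x : X, x ∈ A ↔ altQuant false n (fun ys => R (x, ys))

/-- `Π⁰ₙ`-hardness: every `Π⁰ₙ` set is many-one reducible to `A`. -/
def IsPiHard (n : ℕ) {X : Type} [Primcodable X] (A : Set X) : Prop :=
  ∀ (Y : Type) [Primcodable Y] (C : Set Y), IsPi n C →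
    ManyOneReducible (fun y => y ∈ C) (fun x => x ∈ A)

/-- `Π⁰ₙ`-completeness. -/
def IsPiComplete (n : ℕ) {X : Type} [Primcodable X] (A : Set X) : Prop :=
  IsPi n A ∧ IsPiHard n A

end PGCL

namespace PGCL

/-! A functional presentation of the one-step relation. -/

/-! Membership: within n steps a program reaches only finitely many weighted configurations, so the
partial sums of its survival probabilities are computable rationals, and the expected time is finite
iff these sums have a natural upper bound (`PAST_iff`). There are uncountably many valuations, but a
program sees only finitely many variables (`survive_congr`), so it suffices to quantify over finite
lists of values (`mem_UPAST_iff`). The result is the prefix "for every input there is N such that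
for every n", with a primitive recursive matrix.

Hardness: a condition "for some m, for all j, r m j" says that refuting m = 0, 1, 2, ... in turn
succeeds only finitely often, so it is the finiteness of the domain of a partial recursive function
(`finite_refuteAll_dom`). Recording also the exact fuel at which a computation halts turns this into
finiteness of a set of numbers t with a primitive recursive indicator h (`finite_haltsAt_iff`). The
remaining outer quantifier over n is supplied by the program's input.

It remains to build a program whose expected time is finite iff h(x, n, t) = 1 for finitely many t.
It evaluates h at stages t = 0, 1, 2, ..., and waits whenever the value is 1. A deterministic
evaluation would take unboundedly long as t grows. The remedy is to flip a coin in each iteration of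
a counting loop and to abort on one outcome: the expected time of a loop is then bounded
independently of the number of iterations (`runs_loop`), hence every primitive recursive function is
computed in bounded expected time (`computes_of_primrec'`). A variable records 2^k after k survived
flips. Waiting about 2^k steps, an event of probability 2^(-k), contributes a constant to the
expected time (`ert_stageBody`). A further flip per stage makes the overhead of all stages a
convergent geometric series, so up to constants the expected time counts the t with h = 1
(`le_ert_stages`, `ert_stages_le`).

The estimates use a compositional calculus of expected times with a continuation reward
(`Prog.ert_seq`, `Prog.ert_loop_le`). -/

/-- A possible result of one step: the choices made, their probability, the remaining program and
the new valuation. -/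
structure Outcome : Type where
  word : List Dir
  weight : ℚ
  ctrl : Ctrl
  val : Valuation

/-- Append a program to the remainder of an outcome. -/
def Outcome.andThen (Q : Prog) (o : Outcome) : Outcome :=
  ⟨o.word, o.weight, .seq o.ctrl Q, o.val⟩

/-- The state that an outcome yields from a state with probability `a` and history `θ`. -/
def Outcome.toState (a : ℚ) (θ : List Dir) (o : Outcome) : State :=
  ⟨o.ctrl, o.val, a * o.weight, θ ++ o.word⟩

/-- The effect of an assignment on a valuation. -/
def Valuation.assign (η : Valuation) (v : Var) (e : AExp) : Valuation :=
  Function.update η v ⟨max (e.eval η) 0, le_max_right _ _⟩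

/-- The outcomes of one step of a program. -/
def Prog.succs (η : Valuation) : Prog → List Outcome
  | .assign v e => [⟨[], 1, .done, η.assign v e⟩]
  | .seq P Q => (P.succs η).map (Outcome.andThen Q)
  | .choice p P Q => [⟨[Dir.L], p.val, .prog P, η⟩, ⟨[Dir.R], 1 - p.val, .prog Q, η⟩]
  | .loop b P =>
    if b.eval η then [⟨[], 1, .prog (.seq P (.loop b P)), η⟩] else [⟨[], 1, .done, η⟩]

/-- The outcomes of one step of a remainder. -/
def Ctrl.succs (η : Valuation) : Ctrl → List Outcome
  | .done => []
  | .prog P => P.succs η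
  | .seq c P =>
    match c with
    | .done => [⟨[], 1, .prog P, η⟩]
    | .prog Q => (Q.succs η).map (Outcome.andThen P)
    | .seq c' Q => ((Ctrl.seq c' Q).succs η).map (Outcome.andThen P)

theorem Ctrl.succs_seq {c : Ctrl} (hc : c ≠ .done) (P : Prog) (η : Valuation) :
    (Ctrl.seq c P).succs η = (c.succs η).map (Outcome.andThen P) := by
  cases c <;> simp_all [Ctrl.succs]

/-- Soundness of the outcome list is enough: by `T_succ`, any step found for a given choice
determines `T` on the words starting with that choice, so no converse is needed. -/
theorem Prog.step_of_mem_succs {P : Prog} {η : Valuation} {o : Outcome} (h : o ∈ P.succs η)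
    (a : ℚ) (θ : List Dir) : Step ⟨.prog P, η, a, θ⟩ (o.toState a θ) := by
  induction P generalizing o with
  | assign v e =>
    simp only [Prog.succs, List.mem_singleton] at h
    subst h
    simpa [Outcome.toState, Valuation.assign] using Step.assign v e η a θ
  | seq P Q ih _ =>
    simp only [Prog.succs, List.mem_map] at h
    obtain ⟨o, ho, rfl⟩ := h
    exact Step.concat1 _ _ _ _ _ _ _ _ _ (ih ho)
  | choice p P Q _ _ =>
    simp only [Prog.succs, List.mem_cons, List.not_mem_nil, or_false] at h
    rcases h with rfl | rfl
    · exact Step.prob1 _ _ _ _ _ _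
    · exact Step.prob2 _ _ _ _ _ _
  | loop b P _ =>
    rw [Prog.succs] at h
    split_ifs at h with hb
    all_goals
      simp only [List.mem_singleton] at h
      subst h
    · simpa [Outcome.toState] using Step.while1 b P η a θ hb
    · simpa [Outcome.toState] using Step.while2 b P η a θ (by simpa using hb)

theorem Ctrl.step_of_mem_succs {c : Ctrl} {η : Valuation} {o : Outcome} (h : o ∈ c.succs η)
    (a : ℚ) (θ : List Dir) : Step ⟨c, η, a, θ⟩ (o.toState a θ) := by
  induction c generalizing o with
  | done => simp [Ctrl.succs] at h
  | prog P => exact Prog.step_of_mem_succs h a θ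
  | seq c P ih =>
    by_cases hc : c = .done
    · subst hc
      simp only [Ctrl.succs, List.mem_singleton] at h
      subst h
      simpa [Outcome.toState] using Step.concat2 P η a θ
    · rw [Ctrl.succs_seq hc, List.mem_map] at h
      obtain ⟨o, ho, rfl⟩ := h
      exact Step.concat1' _ _ _ _ _ _ _ _ _ (ih ho)

/-- A step is either deterministic or a probabilistic choice between two outcomes. -/
inductive Branching (l : List Outcome) : Prop
  | det (c : Ctrl) (η : Valuation) (h : l = [⟨[], 1, c, η⟩])
  | prob (p : UnitFrac) (c₁ c₂ : Ctrl) (η₁ η₂ : Valuation)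
      (h : l = [⟨[Dir.L], p.val, c₁, η₁⟩, ⟨[Dir.R], 1 - p.val, c₂, η₂⟩])

theorem Branching.map_andThen {l : List Outcome} (h : Branching l) (Q : Prog) :
    Branching (l.map (Outcome.andThen Q)) := by
  obtain ⟨c, η, rfl⟩ | ⟨p, c₁, c₂, η₁, η₂, rfl⟩ := h
  · exact .det (.seq c Q) η rfl
  · exact .prob p (.seq c₁ Q) (.seq c₂ Q) η₁ η₂ rfl

theorem Prog.branching (P : Prog) (η : Valuation) : Branching (P.succs η) := by
  induction P with
  | assign v e => exact .det _ _ rfl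
  | seq P Q ih _ => exact ih.map_andThen Q
  | choice p P Q _ _ => exact .prob _ _ _ _ _ rfl
  | loop b P _ =>
    rw [Prog.succs]
    split_ifs
    · exact .det _ _ rfl
    · exact .det _ _ rfl

theorem Ctrl.branching {c : Ctrl} (hc : c ≠ .done) (η : Valuation) : Branching (c.succs η) := by
  induction c with
  | done => exact absurd rfl hc
  | prog P => exact P.branching η
  | seq c P ih =>
    by_cases h : c = .done
    · subst h
      exact .det _ _ rfl
    · rw [Ctrl.succs_seq h]
      exact (ih h).map_andThen P

/-! Termination and survival probabilities. -/

/-- Whether something remains to be executed, as a number. -/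
def Ctrl.running : Ctrl → ℚ
  | .done => 0
  | _ => 1

theorem Ctrl.running_of_ne {c : Ctrl} (hc : c ≠ .done) : c.running = 1 := by
  cases c <;> simp_all [Ctrl.running]

/-- The probability of termination after exactly `k` steps. -/
def termAt : ℕ → Ctrl → Valuation → ℚ
  | 0, c, _ => 1 - c.running
  | k + 1, c, η => ((c.succs η).map fun o => o.weight * termAt k o.ctrl o.val).sum

/-- The probability of not having terminated after `k` steps. -/
def survive : ℕ → Ctrl → Valuation → ℚ
  | 0, c, _ => c.running
  | k + 1, c, η => ((c.succs η).map fun o => o.weight * survive k o.ctrl o.val).sum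

theorem T_done (k : ℕ) (η : Valuation) (a : ℚ) (θ w : List Dir) :
    T (k + 1) ⟨.done, η, a, θ⟩ w = none := by
  rw [T, dif_neg]
  rintro ⟨x, b, h, -⟩
  cases h

/-- A word is empty or splits into its first letter and a shorter word; this matches the sum over
words with the first probabilistic choice. -/
theorem sum_words_succ (m : ℕ) (F : List Dir → ℚ) :
    ∑ i ∈ Finset.range (m + 1), ∑ w : Fin i → Dir, F (List.ofFn w) =
      F [] + (∑ i ∈ Finset.range m, ∑ w : Fin i → Dir, F (Dir.L :: List.ofFn w)) +
        ∑ i ∈ Finset.range m, ∑ w : Fin i → Dir, F (Dir.R :: List.ofFn w) := by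
  rw [Finset.sum_range_succ', add_comm, add_assoc, ← Finset.sum_add_distrib]
  congr 1
  · simp
  · refine Finset.sum_congr rfl fun i _ => ?_
    rw [← (Fin.consEquiv fun _ : Fin (i + 1) => Dir).sum_comp, Fintype.sum_prod_type]
    have h : (Finset.univ : Finset Dir) = {Dir.L, Dir.R} := rfl
    rw [h, Finset.sum_pair (by simp)]
    simp [Fin.consEquiv, List.ofFn_succ]

/-- The length bound m is free above k, because a deterministic step uses up a step but no letter,
while a choice uses up one of each. -/
theorem sum_alpha_T (k m : ℕ) (hm : k < m) (c : Ctrl) (η : Valuation) (a : ℚ) (θ : List Dir) :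
    ∑ i ∈ Finset.range m, ∑ w : Fin i → Dir, alpha (T k ⟨c, η, a, θ⟩ (List.ofFn w)) =
      a * termAt k c η := by
  induction k generalizing m c η a θ with
  | zero =>
    obtain ⟨m, rfl⟩ : ∃ n, m = n + 1 := ⟨m - 1, by omega⟩
    rw [sum_words_succ m fun w => alpha (T 0 ⟨c, η, a, θ⟩ w)]
    cases c <;> simp [T, alpha, termAt, Ctrl.running]
  | succ k ih =>
    by_cases hc : c = .done
    · subst hc
      simp [T_done, alpha, termAt, Ctrl.succs]
    have hs := fun o h => Ctrl.step_of_mem_succs (c := c) (η := η) (o := o) h a θ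
    obtain ⟨c', η', e⟩ | ⟨p, c₁, c₂, η₁, η₂, e⟩ := Ctrl.branching hc η
    · have h := hs ⟨[], 1, c', η'⟩ (by simp [e])
      have hT := fun w => T_succ k w h (b := []) rfl
      simp only [List.nil_append, Outcome.toState] at hT
      simp only [hT, ih m (by omega), termAt, e]
      simp
    · have h₁ := hs ⟨[Dir.L], p.val, c₁, η₁⟩ (by simp [e])
      have h₂ := hs ⟨[Dir.R], 1 - p.val, c₂, η₂⟩ (by simp [e])
      have hT₁ := fun w => T_succ k w h₁ (b := [Dir.L]) rfl
      have hT₂ := fun w => T_succ k w h₂ (b := [Dir.R]) rfl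
      -- The empty word contributes nothing here: by determinism every step lengthens the history.
      have hn : T (k + 1) ⟨c, η, a, θ⟩ [] = none := by
        rw [T, dif_neg]
        rintro ⟨x, b, h, hb, -, hw⟩
        obtain ⟨rfl, -⟩ := List.append_eq_nil_iff.1 hw.symm
        have := (h.det h₁).1
        rw [hb] at this
        simp [Outcome.toState] at this
      obtain ⟨m, rfl⟩ : ∃ n, m = n + 1 := ⟨m - 1, by omega⟩
      rw [sum_words_succ m fun w => alpha (T (k + 1) ⟨c, η, a, θ⟩ w)]
      simp only [List.cons_append, List.nil_append, Outcome.toState] at hT₁ hT₂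
      simp only [hT₁, hT₂, hn, ih m (by omega), termAt, e, show alpha none = 0 from rfl]
      simp only [List.map_cons, List.map_nil, List.sum_cons, List.sum_nil]
      ring

theorem termProbAt_eq (P : Prog) (η : Valuation) (k : ℕ) :
    termProbAt P η k = termAt k (.prog P) η := by
  rw [termProbAt, initState, sum_alpha_T k (k + 1) (by omega), one_mul]

/-- Both sides obey the same recursion, since the weights of the outcomes of a step sum to one. -/
theorem one_sub_sum_termAt (k : ℕ) (c : Ctrl) (η : Valuation) :
    1 - ∑ j ∈ Finset.range (k + 1), termAt j c η = survive k c η := by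
  induction k generalizing c η with
  | zero => simp [termAt, survive]
  | succ k ih =>
    rw [Finset.sum_range_succ']
    by_cases hc : c = .done
    · subst hc
      simp [termAt, survive, Ctrl.succs, Ctrl.running]
    · have h := fun c' η' => eq_sub_of_add_eq' (sub_eq_iff_eq_add.1 (ih c' η')).symm
      obtain ⟨c', η', e⟩ | ⟨p, c₁, c₂, η₁, η₂, e⟩ := Ctrl.branching hc η
      · simp [termAt, survive, Ctrl.running_of_ne hc, e, h]
      · simp only [termAt, survive, Ctrl.running_of_ne hc, e, List.map_cons, List.map_nil,
          List.sum_cons, List.sum_nil, Finset.sum_add_distrib, ← Finset.mul_sum, add_zero, h]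
        ring

theorem one_sub_termProbWithin (P : Prog) (η : Valuation) (k : ℕ) :
    1 - termProbWithin P η k = survive k (.prog P) η := by
  simp only [termProbWithin, termProbAt_eq, one_sub_sum_termAt]

theorem UnitFrac.val_nonneg (p : UnitFrac) : 0 ≤ p.val := by
  rw [UnitFrac.val]; positivity

theorem UnitFrac.val_le_one (p : UnitFrac) : p.val ≤ 1 := by
  rw [UnitFrac.val]
  exact div_le_one_of_le₀ (by exact_mod_cast p.num_le) (by positivity)

theorem survive_done (k : ℕ) (η : Valuation) : survive k .done η = 0 := by
  cases k <;> simp [survive, Ctrl.running, Ctrl.succs]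

theorem survive_nonneg (k : ℕ) (c : Ctrl) (η : Valuation) : 0 ≤ survive k c η := by
  induction k generalizing c η with
  | zero => cases c <;> simp [survive, Ctrl.running]
  | succ k ih =>
    by_cases hc : c = .done
    · rw [hc, survive_done]
    · obtain ⟨c', η', e⟩ | ⟨p, c₁, c₂, η₁, η₂, e⟩ := Ctrl.branching hc η
      · simpa [survive, e] using ih c' η'
      · have h₁ := mul_nonneg p.val_nonneg (ih c₁ η₁)
        have h₂ := mul_nonneg (sub_nonneg.2 p.val_le_one) (ih c₂ η₂)
        simpa [survive, e] using add_nonneg h₁ h₂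

/-! Expected times with a continuation. -/

/-- The expected value of `f` after one step. -/
noncomputable def Ctrl.mean (c : Ctrl) (η : Valuation) (F : Ctrl → Valuation → ℝ≥0∞) : ℝ≥0∞ :=
  ((c.succs η).map fun o => ENNReal.ofReal o.weight * F o.ctrl o.val).sum

open Classical in
/-- The expected time spent within `n` steps, where termination in `η` is rewarded by `f η`. -/
noncomputable def ertWithin (f : Valuation → ℝ≥0∞) : ℕ → Ctrl → Valuation → ℝ≥0∞
  | 0, _, _ => 0
  | n + 1, c, η => if c = .done then f η else 1 + c.mean η (ertWithin f n)

/-- The expectation of a truncated running time is the sum of its tail probabilities. -/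
theorem ertWithin_zero_eq (n : ℕ) (c : Ctrl) (η : Valuation) :
    ertWithin 0 n c η = ENNReal.ofReal ((∑ k ∈ Finset.range n, survive k c η : ℚ) : ℝ) := by
  have hnn : ∀ n c η, (0 : ℝ) ≤ ((∑ k ∈ Finset.range n, survive k c η : ℚ) : ℝ) := fun n c η => by
    exact_mod_cast Finset.sum_nonneg fun k _ => survive_nonneg k c η
  induction n generalizing c η with
  | zero => simp [ertWithin]
  | succ n ih =>
    rw [ertWithin]
    split_ifs with hc
    · simp [hc, survive_done]
    · rw [Finset.sum_range_succ', Rat.cast_add, add_comm (1 : ℝ≥0∞), ENNReal.ofReal_add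
        (by exact_mod_cast Finset.sum_nonneg fun k _ => survive_nonneg (k + 1) c η)
        (by simp [survive, Ctrl.running_of_ne hc])]
      congr 1
      · obtain ⟨c', η', e⟩ | ⟨p, c₁, c₂, η₁, η₂, e⟩ := Ctrl.branching hc η
        · simp [Ctrl.mean, survive, e, ih]
        · have hp : (0 : ℝ) ≤ (p.val : ℝ) := by exact_mod_cast p.val_nonneg
          have hq : (0 : ℝ) ≤ ((1 - p.val : ℚ) : ℝ) := by
            exact_mod_cast sub_nonneg.2 p.val_le_one
          simp only [Ctrl.mean, survive, e, ih, List.map_cons, List.map_nil, List.sum_cons,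
            List.sum_nil, Finset.sum_add_distrib, ← Finset.mul_sum, add_zero, Rat.cast_add]
          rw [ENNReal.ofReal_add, Rat.cast_mul, Rat.cast_mul, ENNReal.ofReal_mul hp,
            ENNReal.ofReal_mul hq]
          · rw [Rat.cast_mul]
            exact mul_nonneg hp (hnn n c₁ η₁)
          · rw [Rat.cast_mul]
            exact mul_nonneg hq (hnn n c₂ η₂)
      · simp [survive, Ctrl.running_of_ne hc]

theorem expectedTime_eq_iSup (P : Prog) (η : Valuation) :
    expectedTime P η = ⨆ n, ertWithin 0 n (.prog P) η := by
  rw [expectedTime, ENNReal.tsum_eq_iSup_nat]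
  refine iSup_congr fun n => ?_
  rw [ertWithin_zero_eq, Rat.cast_sum, ENNReal.ofReal_sum_of_nonneg]
  · refine Finset.sum_congr rfl fun k _ => ?_
    rw [← one_sub_termProbWithin]
    simp
  · intro k _
    exact_mod_cast survive_nonneg k _ η

theorem Ctrl.mean_mono (c : Ctrl) (η : Valuation) {F G : Ctrl → Valuation → ℝ≥0∞}
    (h : ∀ c η, F c η ≤ G c η) : c.mean η F ≤ c.mean η G :=
  List.sum_le_sum fun _ _ => mul_le_mul_right (h _ _) _

theorem Ctrl.mean_seq {c : Ctrl} (hc : c ≠ .done) (P : Prog) (η : Valuation)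
    (F : Ctrl → Valuation → ℝ≥0∞) :
    (Ctrl.seq c P).mean η F = c.mean η fun c' η' => F (.seq c' P) η' := by
  simp [Ctrl.mean, Ctrl.succs_seq hc, Outcome.andThen, Function.comp_def]

theorem ertWithin_mono (f : Valuation → ℝ≥0∞) : Monotone (ertWithin f) := by
  refine monotone_nat_of_le_succ fun n => ?_
  induction n with
  | zero => exact fun c η => zero_le
  | succ n ih =>
    intro c η
    rw [ertWithin, ertWithin]
    split_ifs
    · exact le_rfl
    · exact add_le_add le_rfl (Ctrl.mean_mono c η ih)

theorem ertWithin_mono_right {f g : Valuation → ℝ≥0∞} (h : ∀ η, f η ≤ g η) (n : ℕ) (c : Ctrl)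
    (η : Valuation) : ertWithin f n c η ≤ ertWithin g n c η := by
  induction n generalizing c η with
  | zero => exact le_rfl
  | succ n ih =>
    rw [ertWithin, ertWithin]
    split_ifs
    · exact h η
    · exact add_le_add le_rfl (Ctrl.mean_mono c η ih)

/-- The expected time of a remainder, where termination in `η` is rewarded by `f η`. -/
noncomputable def Ctrl.ert (c : Ctrl) (f : Valuation → ℝ≥0∞) (η : Valuation) : ℝ≥0∞ :=
  ⨆ n, ertWithin f n c η

/-- The expected time of a program, where termination in `η` is rewarded by `f η`. -/
noncomputable def Prog.ert (P : Prog) (f : Valuation → ℝ≥0∞) (η : Valuation) : ℝ≥0∞ :=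
  (Ctrl.prog P).ert f η

theorem expectedTime_eq_ert (P : Prog) (η : Valuation) : expectedTime P η = P.ert 0 η :=
  expectedTime_eq_iSup P η

theorem ertWithin_le_ert (f : Valuation → ℝ≥0∞) (n : ℕ) (c : Ctrl) (η : Valuation) :
    ertWithin f n c η ≤ c.ert f η :=
  le_iSup (fun n => ertWithin f n c η) n

theorem Ctrl.ert_mono (c : Ctrl) {f g : Valuation → ℝ≥0∞} (h : ∀ η, f η ≤ g η) (η : Valuation) :
    c.ert f η ≤ c.ert g η :=
  iSup_mono fun n => ertWithin_mono_right h n c η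

theorem iSup_ertWithin_succ (f : Valuation → ℝ≥0∞) (c : Ctrl) (η : Valuation) :
    c.ert f η = ⨆ n, ertWithin f (n + 1) c η :=
  (Monotone.iSup_nat_add (fun _ _ h => ertWithin_mono f h c η) 1).symm

theorem Ctrl.ert_done (f : Valuation → ℝ≥0∞) (η : Valuation) : Ctrl.done.ert f η = f η := by
  rw [iSup_ertWithin_succ]
  simp [ertWithin]

/-- Monotone convergence: the supremum over the step bound passes through the weighted sum over at
most two outcomes. -/
theorem Ctrl.ert_of_ne {c : Ctrl} (hc : c ≠ .done) (f : Valuation → ℝ≥0∞) (η : Valuation) :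
    c.ert f η = 1 + c.mean η fun c' η' => c'.ert f η' := by
  have hm : ∀ a c' η', Monotone fun n => a * ertWithin f n c' η' := fun a c' η' _ _ h =>
    mul_le_mul_right (ertWithin_mono f h c' η') a
  rw [iSup_ertWithin_succ]
  simp only [ertWithin, hc, if_false]
  rw [← ENNReal.add_iSup]
  congr 1
  obtain ⟨c', η', e⟩ | ⟨p, c₁, c₂, η₁, η₂, e⟩ := Ctrl.branching hc η
  · simp [Ctrl.mean, e, Ctrl.ert]
  · simp only [Ctrl.mean, e, Ctrl.ert, List.map_cons, List.map_nil, List.sum_cons, List.sum_nil,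
      add_zero, ENNReal.mul_iSup]
    rw [ENNReal.iSup_add_iSup_of_monotone (hm _ _ _) (hm _ _ _)]

/-- On the right `P` gets n steps regardless of how many the first component has used, hence only an
inequality. The administrative step from `↓; P` to `P` accounts for the drop from n + 1 to n and for
the added 1. -/
theorem ertWithin_seq_le (f : Valuation → ℝ≥0∞) (n : ℕ) (c : Ctrl) (P : Prog) (η : Valuation) :
    ertWithin f (n + 1) (.seq c P) η ≤
      ertWithin (fun η' => 1 + ertWithin f n (.prog P) η') (n + 1) c η := by
  induction n generalizing c η with
  | zero =>
    rw [ertWithin, ertWithin, if_neg (by simp)]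
    split_ifs with hc
    · subst hc
      simp [Ctrl.mean, Ctrl.succs, ertWithin]
    · exact add_le_add le_rfl (by rw [Ctrl.mean_seq hc]; exact Ctrl.mean_mono _ _ fun _ _ => le_rfl)
  | succ n ih =>
    rw [ertWithin, ertWithin, if_neg (by simp)]
    split_ifs with hc
    · subst hc
      simp [Ctrl.mean, Ctrl.succs]
    · refine add_le_add le_rfl ?_
      rw [Ctrl.mean_seq hc]
      refine Ctrl.mean_mono _ _ fun c' η' => (ih c' η').trans ?_
      exact ertWithin_mono_right
        (fun η => add_le_add le_rfl (ertWithin_mono f (Nat.le_succ n) _ η)) _ _ _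

/-- The generous step bound of `ertWithin_seq_le` does no harm in the limit; the converse unfolds
the first component step by step. -/
theorem Ctrl.ert_seq (c : Ctrl) (P : Prog) (f : Valuation → ℝ≥0∞) (η : Valuation) :
    (Ctrl.seq c P).ert f η = c.ert (fun η' => 1 + P.ert f η') η := by
  apply le_antisymm
  · rw [iSup_ertWithin_succ]
    refine iSup_le fun n => (ertWithin_seq_le f n c P η).trans ?_
    refine (ertWithin_le_ert _ _ _ _).trans (Ctrl.ert_mono _ (fun η => ?_) _)
    exact add_le_add le_rfl (ertWithin_le_ert _ _ _ _)
  · refine iSup_le fun n => ?_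
    induction n generalizing c η with
    | zero => exact zero_le
    | succ n ih =>
      rw [ertWithin]
      split_ifs with hc
      · subst hc
        rw [Ctrl.ert_of_ne (by simp)]
        simp [Ctrl.mean, Ctrl.succs, Prog.ert]
      · rw [Ctrl.ert_of_ne (by simp), Ctrl.mean_seq hc]
        exact add_le_add le_rfl (Ctrl.mean_mono _ _ fun c' η' => ih c' η')

theorem ertWithin_prog_seq (f : Valuation → ℝ≥0∞) (n : ℕ) (P Q : Prog) (η : Valuation) :
    ertWithin f n (.prog (.seq P Q)) η = ertWithin f n (.seq (.prog P) Q) η := by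
  cases n with
  | zero => rfl
  | succ n => simp [ertWithin, Ctrl.mean, Ctrl.succs, Prog.succs]

theorem Prog.ert_assign (v : Var) (e : AExp) (f : Valuation → ℝ≥0∞) (η : Valuation) :
    (Prog.assign v e).ert f η = 1 + f (η.assign v e) := by
  rw [Prog.ert, Ctrl.ert_of_ne (by simp)]
  simp [Ctrl.mean, Ctrl.succs, Prog.succs, Ctrl.ert_done]

theorem Prog.ert_seq (P Q : Prog) (f : Valuation → ℝ≥0∞) (η : Valuation) :
    (Prog.seq P Q).ert f η = P.ert (fun η' => 1 + Q.ert f η') η := by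
  rw [Prog.ert, Prog.ert, ← Ctrl.ert_seq]
  exact iSup_congr fun n => ertWithin_prog_seq f n P Q η

theorem Prog.ert_choice (p : UnitFrac) (P Q : Prog) (f : Valuation → ℝ≥0∞) (η : Valuation) :
    (Prog.choice p P Q).ert f η =
      1 + (ENNReal.ofReal p.val * P.ert f η + ENNReal.ofReal (1 - p.val) * Q.ert f η) := by
  rw [Prog.ert, Ctrl.ert_of_ne (by simp)]
  simp [Ctrl.mean, Ctrl.succs, Prog.succs, Prog.ert]

theorem Prog.ert_loop_of_true {b : BExp} {η : Valuation} (hb : b.eval η = true) (P : Prog)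
    (f : Valuation → ℝ≥0∞) :
    (Prog.loop b P).ert f η = 1 + P.ert (fun η' => 1 + (Prog.loop b P).ert f η') η := by
  conv_lhs => rw [Prog.ert, Ctrl.ert_of_ne (by simp)]
  rw [← Prog.ert_seq]
  simp [Ctrl.mean, Ctrl.succs, Prog.succs, hb, Prog.ert]

theorem Prog.ert_loop_of_false {b : BExp} {η : Valuation} (hb : b.eval η = false) (P : Prog)
    (f : Valuation → ℝ≥0∞) : (Prog.loop b P).ert f η = 1 + f η := by
  rw [Prog.ert, Ctrl.ert_of_ne (by simp)]
  simp [Ctrl.mean, Ctrl.succs, Prog.succs, hb, Ctrl.ert_done]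

/-- Every pre-fixed point of the characteristic functional of a loop bounds its expected time. -/
theorem Prog.ert_loop_le {b : BExp} {P : Prog} {f I : Valuation → ℝ≥0∞}
    (h₁ : ∀ η, b.eval η = true → 1 + P.ert (fun η' => 1 + I η') η ≤ I η)
    (h₂ : ∀ η, b.eval η = false → 1 + f η ≤ I η) (η : Valuation) :
    (Prog.loop b P).ert f η ≤ I η := by
  refine iSup_le fun n => ?_
  induction n using Nat.strong_induction_on generalizing η with
  | _ n ih =>
    cases hb : b.eval η with
    | false =>
      refine le_trans ((ertWithin_le_ert f n _ η).trans_eq ?_) (h₂ η hb)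
      exact Prog.ert_loop_of_false hb P f
    | true =>
      -- An iteration spends one step on the guard and one on `↓; loop`, so the induction hypothesis
      -- is used two steps lower. Step bounds 0 and 1 are too short for that and are treated
      -- directly.
      obtain _ | _ | n := n
      · exact zero_le
      · refine le_trans ?_ (h₁ η hb)
        simp [ertWithin, Ctrl.mean, Ctrl.succs, Prog.succs, hb]
      · refine le_trans ?_ (h₁ η hb)
        rw [ertWithin, if_neg (by simp)]
        refine add_le_add le_rfl ?_
        have e : (Ctrl.prog (.loop b P)).mean η (ertWithin f (n + 1)) =
            ertWithin f (n + 1) (.prog (.seq P (.loop b P))) η := by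
          simp [Ctrl.mean, Ctrl.succs, Prog.succs, hb]
        rw [e, ertWithin_prog_seq]
        refine (ertWithin_seq_le f n _ _ η).trans ((ertWithin_le_ert _ _ _ _).trans ?_)
        exact Ctrl.ert_mono _ (fun η' => add_le_add le_rfl (ih n (by omega) η')) η

/-! Programs that may be aborted by coin flips. Variable `0` is the abortion flag, and variable `1`
holds `2 ^ k` after `k` coin flips without abortion. -/

theorem Valuation.assign_eq {η : Valuation} {e : AExp} {q : ℚ≥0} (h : e.eval η = (q : ℚ))
    (v : Var) : η.assign v e = Function.update η v q := by
  rw [Valuation.assign]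
  congr 1
  ext
  simp [h]
  rfl

theorem Valuation.assign_apply_of_ne (η : Valuation) {v x : Var} (h : x ≠ v) (e : AExp) :
    η.assign v e x = η x :=
  Function.update_of_ne h _ _

/-- The program started in an aborted state adds at most `L` to the expected time. -/
def StopBound (Q : Prog) (L : ℕ) : Prop :=
  ∀ η : Valuation, η 0 ≠ 0 → ∀ (g : Valuation → ℝ≥0∞) (B : ℝ≥0∞),
    (∀ η' : Valuation, η' 0 ≠ 0 → g η' ≤ B) → Q.ert g η ≤ L + B

/-- With probability `2 ^ (-k)` the program leads from `η` to `η'` without abortion; it is aborted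
otherwise, and takes at most the expected time `K`. -/
structure Runs (Q : Prog) (K k : ℕ) (η η' : Valuation) : Prop where
  flag : η' 0 = 0
  cost : η' 1 = 2 ^ k * η 1
  lower : ∀ g : Valuation → ℝ≥0∞, 2⁻¹ ^ k * g η' ≤ Q.ert g η
  upper : ∀ (g : Valuation → ℝ≥0∞) (B p : ℝ≥0∞), p + 2⁻¹ ^ k = 1 →
    (∀ η'' : Valuation, η'' 0 ≠ 0 → g η'' ≤ B) → Q.ert g η ≤ K + p * B + 2⁻¹ ^ k * g η'

theorem half_pow_le_one (k : ℕ) : (2⁻¹ : ℝ≥0∞) ^ k ≤ 1 :=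
  pow_le_one₀ zero_le (by simp)

theorem half_pow_mul_two_pow (k : ℕ) : (2⁻¹ : ℝ≥0∞) ^ k * 2 ^ k = 1 := by
  rw [← mul_pow, ENNReal.inv_mul_cancel (by simp) (by simp), one_pow]

theorem exists_add_half_pow (k : ℕ) : ∃ p : ℝ≥0∞, p + 2⁻¹ ^ k = 1 ∧ p ≤ 1 :=
  ⟨1 - 2⁻¹ ^ k, tsub_add_cancel_of_le (half_pow_le_one k), tsub_le_self⟩

/-- Abortion probabilities of a concatenation: either the first part aborts, or it survives and the
second part aborts. -/
theorem add_mul_eq_of_half_pow {k₁ k₂ : ℕ} {p p₁ p₂ : ℝ≥0∞} (h : p + 2⁻¹ ^ (k₁ + k₂) = 1)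
    (h₁ : p₁ + 2⁻¹ ^ k₁ = 1) (h₂ : p₂ + 2⁻¹ ^ k₂ = 1) : p₁ + 2⁻¹ ^ k₁ * p₂ = p := by
  have e : p₁ + 2⁻¹ ^ k₁ * p₂ + 2⁻¹ ^ (k₁ + k₂) = p + 2⁻¹ ^ (k₁ + k₂) := by
    rw [h, ← h₁, pow_add, add_assoc, ← mul_add, h₂, mul_one]
  exact (ENNReal.add_left_inj (ne_top_of_le_ne_top ENNReal.one_ne_top (half_pow_le_one _))).1 e

theorem StopBound.seq {Q₁ Q₂ : Prog} {L₁ L₂ : ℕ} (h₁ : StopBound Q₁ L₁) (h₂ : StopBound Q₂ L₂) :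
    StopBound (.seq Q₁ Q₂) (L₁ + L₂ + 1) := by
  intro η hη g B hg
  rw [Prog.ert_seq]
  refine (h₁ η hη _ (1 + (L₂ + B)) fun η' h' => add_le_add le_rfl (h₂ η' h' g B hg)).trans_eq ?_
  push_cast
  ring

theorem stopBound_assign {v : ℕ} (hv : v ≠ 0) (e : AExp) : StopBound (.assign v e) 1 := by
  intro η hη g B hg
  rw [Prog.ert_assign, Nat.cast_one]
  exact add_le_add le_rfl (hg _ (by rwa [Valuation.assign_apply_of_ne η hv.symm]))

/-- Every guard also tests the abortion flag, so an aborted run leaves each loop at its first test.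
-/
theorem stopBound_loop {b : BExp} (hb : ∀ η : Valuation, η 0 ≠ 0 → b.eval η = false) (P : Prog) :
    StopBound (.loop b P) 1 := by
  intro η hη g B hg
  rw [Prog.ert_loop_of_false (hb η hη), Nat.cast_one]
  exact add_le_add le_rfl (hg η hη)

/-- Set the abortion flag with probability one half, and double the cost otherwise. -/
def flip : Prog :=
  .choice ⟨1, 2, by norm_num, by norm_num⟩ (.assign 1 (.add (.var 1) (.var 1)))
    (.assign 0 (.const 1 0))

/-- The constant 2 is one step for the choice and one for the assignment in either branch. -/
theorem ert_flip (g : Valuation → ℝ≥0∞) (η : Valuation) :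
    flip.ert g η = 2 + 2⁻¹ * g (Function.update η 1 (2 * η 1)) +
      2⁻¹ * g (Function.update η 0 1) := by
  have h₁ : η.assign 1 (.add (.var 1) (.var 1)) = Function.update η 1 (2 * η 1) :=
    Valuation.assign_eq (by simp [AExp.eval]; ring) _
  have h₂ : η.assign 0 (.const 1 0) = Function.update η 0 1 :=
    Valuation.assign_eq (by simp [AExp.eval]) _
  have hp : ENNReal.ofReal ((⟨1, 2, by norm_num, by norm_num⟩ : UnitFrac).val : ℝ) = 2⁻¹ := by
    rw [show ((⟨1, 2, by norm_num, by norm_num⟩ : UnitFrac).val : ℝ) = 2⁻¹ by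
      simp [UnitFrac.val], ENNReal.ofReal_inv_of_pos (by norm_num)]
    simp
  have hq : ENNReal.ofReal (1 - ((⟨1, 2, by norm_num, by norm_num⟩ : UnitFrac).val : ℝ)) = 2⁻¹ := by
    rw [show 1 - ((⟨1, 2, by norm_num, by norm_num⟩ : UnitFrac).val : ℝ) = 2⁻¹ by
      simp [UnitFrac.val]; norm_num, ENNReal.ofReal_inv_of_pos (by norm_num)]
    simp
  rw [flip, Prog.ert_choice, hp, hq, Prog.ert_assign, Prog.ert_assign, h₁, h₂, mul_add, mul_add,
    mul_one]
  have h := ENNReal.inv_two_add_inv_two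
  calc _ = 1 + (2⁻¹ + 2⁻¹) + 2⁻¹ * g (Function.update η 1 (2 * η 1)) +
      2⁻¹ * g (Function.update η 0 1) := by ring
    _ = _ := by rw [h, one_add_one_eq_two]

theorem stopBound_flip : StopBound flip 2 := by
  intro η hη g B hg
  rw [ert_flip]
  have h₁ := hg (Function.update η 1 (2 * η 1)) (by simpa using hη)
  have h₂ := hg (Function.update η 0 1) (by simp)
  calc _ ≤ 2 + 2⁻¹ * B + 2⁻¹ * B := by gcongr
    _ = 2 + (2⁻¹ + 2⁻¹) * B := by ring
    _ = _ := by rw [ENNReal.inv_two_add_inv_two, one_mul]; rfl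

theorem runs_flip {η : Valuation} (hη : η 0 = 0) :
    Runs flip 2 1 η (Function.update η 1 (2 * η 1)) where
  flag := by simpa using hη
  cost := by simp
  lower g := by
    rw [ert_flip, pow_one]
    exact le_add_right (le_add_left le_rfl)
  upper g B p hp hg := by
    have h : p = 2⁻¹ := by
      rw [pow_one, ← ENNReal.inv_two_add_inv_two] at hp
      exact (ENNReal.add_left_inj (by simp)).1 hp
    have h₂ := hg (Function.update η 0 1) (by simp)
    rw [ert_flip, pow_one, h]
    calc _ ≤ 2 + 2⁻¹ * g (Function.update η 1 (2 * η 1)) + 2⁻¹ * B := by gcongr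
      _ = _ := by push_cast; ring

theorem runs_assign {η : Valuation} (hη : η 0 = 0) {v : ℕ} (hv : 2 ≤ v) {e : AExp} {q : ℚ≥0}
    (h : e.eval η = (q : ℚ)) : Runs (.assign v e) 1 0 η (Function.update η v q) where
  flag := by rwa [Function.update_of_ne (show (0 : ℕ) ≠ v by omega)]
  cost := by rw [Function.update_of_ne (show (1 : ℕ) ≠ v by omega), pow_zero, one_mul]
  lower g := by
    rw [Prog.ert_assign, Valuation.assign_eq h, pow_zero, one_mul]
    exact le_add_left le_rfl
  upper g B p _ _ := by
    rw [Prog.ert_assign, Valuation.assign_eq h, pow_zero, one_mul, Nat.cast_one, add_assoc]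
    exact add_le_add le_rfl (le_add_left le_rfl)

/-- A run aborted in the first program still passes through the second, which costs `L₂`; the
summand 2 pays for the step between the programs, once for the aborted and once for the surviving
run. -/
theorem Runs.seq {Q₁ Q₂ : Prog} {K₁ K₂ L₂ k₁ k₂ : ℕ} {η η₁ η₂ : Valuation}
    (h₁ : Runs Q₁ K₁ k₁ η η₁) (h₂ : Runs Q₂ K₂ k₂ η₁ η₂) (hL : StopBound Q₂ L₂) :
    Runs (.seq Q₁ Q₂) (K₁ + K₂ + L₂ + 2) (k₁ + k₂) η η₂ where
  flag := h₂.flag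
  cost := by rw [h₂.cost, h₁.cost, ← mul_assoc, ← pow_add, add_comm k₂]
  lower g := by
    rw [Prog.ert_seq, pow_add, mul_assoc]
    refine le_trans ?_ (h₁.lower _)
    gcongr
    exact (h₂.lower g).trans (le_add_left le_rfl)
  upper g B p hp hg := by
    obtain ⟨p₁, e₁, l₁⟩ := exists_add_half_pow k₁
    obtain ⟨p₂, e₂, l₂⟩ := exists_add_half_pow k₂
    rw [Prog.ert_seq, ← add_mul_eq_of_half_pow hp e₁ e₂, pow_add]
    have u₁ := h₁.upper (fun η' => 1 + Q₂.ert g η') (1 + (L₂ + B)) p₁ e₁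
      fun η' h' => add_le_add le_rfl (hL η' h' g B hg)
    have u₂ := h₂.upper g B p₂ e₂ hg
    have q₁ := half_pow_le_one k₁
    generalize (2⁻¹ : ℝ≥0∞) ^ k₁ = a at *
    calc _ ≤ _ := u₁
      _ ≤ K₁ + p₁ * (1 + (L₂ + B)) + a * (1 + (K₂ + p₂ * B + 2⁻¹ ^ k₂ * g η₂)) := by gcongr
      _ = K₁ + p₁ * (1 + L₂) + a * (1 + K₂) + (p₁ + a * p₂) * B + a * 2⁻¹ ^ k₂ * g η₂ := by ring
      _ ≤ K₁ + 1 * (1 + L₂) + 1 * (1 + K₂) + (p₁ + a * p₂) * B + a * 2⁻¹ ^ k₂ * g η₂ := by gcongr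
      _ = _ := by push_cast; ring

/-- A loop whose iterations contain coin flips runs in bounded expected time. -/
theorem runs_loop {b : BExp} {P : Prog} {K : ℕ} (J : ℕ → Valuation → Prop)
    (hb : ∀ η : Valuation, η 0 ≠ 0 → b.eval η = false)
    (h₀ : ∀ η, J 0 η → b.eval η = false ∧ η 0 = 0)
    (h₁ : ∀ m η, J (m + 1) η → b.eval η = true ∧ ∃ k η', Runs P K (k + 1) η η' ∧ J m η')
    (m : ℕ) (η : Valuation) (hη : J m η) :
    ∃ k η', Runs (.loop b P) (2 * K + 8) k η η' ∧ J 0 η' := by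
  induction m generalizing η with
  | zero =>
    obtain ⟨hf, hs⟩ := h₀ η hη
    refine ⟨0, η, ⟨hs, by simp, fun g => ?_, fun g B p _ _ => ?_⟩, hη⟩
    · rw [Prog.ert_loop_of_false hf, pow_zero, one_mul]
      exact le_add_left le_rfl
    · rw [Prog.ert_loop_of_false hf, pow_zero, one_mul]
      refine add_le_add (le_add_right ?_) le_rfl
      exact_mod_cast (by omega : 1 ≤ 2 * K + 8)
  | succ m ih =>
    obtain ⟨ht, k₁, η₁, r₁, hj⟩ := h₁ m η hη
    obtain ⟨k₂, η₂, r₂, hj₂⟩ := ih η₁ hj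
    refine ⟨k₁ + 1 + k₂, η₂, ⟨r₂.flag, ?_, fun g => ?_, fun g B p hp hg => ?_⟩, hj₂⟩
    · rw [r₂.cost, r₁.cost, ← mul_assoc, ← pow_add, add_comm k₂]
    · rw [Prog.ert_loop_of_true ht, pow_add _ (k₁ + 1), mul_assoc]
      refine le_trans ?_ (le_add_left (r₁.lower _))
      gcongr
      exact (r₂.lower g).trans (le_add_left le_rfl)
    · obtain ⟨p₁, e₁, l₁⟩ := exists_add_half_pow (k₁ + 1)
      obtain ⟨p₂, e₂, l₂⟩ := exists_add_half_pow k₂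
      rw [Prog.ert_loop_of_true ht, ← add_mul_eq_of_half_pow hp e₁ e₂, pow_add _ (k₁ + 1)]
      have u₁ := r₁.upper (fun η' => 1 + (Prog.loop b P).ert g η') (1 + (1 + B)) p₁ e₁
        fun η' h' => by
          rw [Prog.ert_loop_of_false (hb η' h')]
          exact add_le_add le_rfl (add_le_add le_rfl (hg η' h'))
      have u₂ := r₂.upper g B p₂ e₂ hg
      have q₁ : (2⁻¹ : ℝ≥0∞) ^ (k₁ + 1) ≤ 2⁻¹ := by
        rw [pow_succ]
        exact mul_le_of_le_one_left zero_le (half_pow_le_one k₁)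
      have q₂ := half_pow_le_one (k₁ + 1)
      generalize (2⁻¹ : ℝ≥0∞) ^ (k₁ + 1) = a at *
      -- The bound X = 2K + 8 solves 1 + K + 2 + 1 + X/2 = X: guard, body, the two steps by which an
      -- aborted run leaves the loop, the step back to the loop, and the remaining iterations. These
      -- are reached with probability at most 1/2, because the body flips at least one coin.
      have hh : (2⁻¹ : ℝ≥0∞) * ((2 * K + 8 : ℕ) : ℝ≥0∞) = K + 4 := by
        have : ((2 * K + 8 : ℕ) : ℝ≥0∞) = 2 * (K + 4) := by push_cast; ring
        rw [this, ← mul_assoc, ENNReal.inv_mul_cancel (by simp) (by simp), one_mul]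
      calc _ ≤ _ := add_le_add le_rfl u₁
        _ ≤ 1 + (K + p₁ * (1 + (1 + B)) + a * (1 + (((2 * K + 8 : ℕ) : ℝ≥0∞) + p₂ * B +
            2⁻¹ ^ k₂ * g η₂))) := by gcongr
        _ = 1 + K + p₁ * 2 + a * 1 + a * ((2 * K + 8 : ℕ) : ℝ≥0∞) + (p₁ + a * p₂) * B +
            a * 2⁻¹ ^ k₂ * g η₂ := by ring
        _ ≤ 1 + K + 1 * 2 + 1 * 1 + 2⁻¹ * ((2 * K + 8 : ℕ) : ℝ≥0∞) + (p₁ + a * p₂) * B +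
            a * 2⁻¹ ^ k₂ * g η₂ := by gcongr
        _ = _ := by rw [hh]; push_cast; ring

/-! Compilation of primitive recursive functions. -/

/-- `Q` computes `f` from the variables `ins` into `out`, and changes no other variables below `b`
except for the abortion flag and the cost. -/
structure ComputesWith {n : ℕ} (f : List.Vector ℕ n → ℕ) (ins : Fin n → ℕ) (out b : ℕ) (Q : Prog)
    (K L : ℕ) : Prop where
  aborted : StopBound Q L
  run : ∀ (η : Valuation) (v : List.Vector ℕ n), η 0 = 0 → (∀ i, η (ins i) = v.get i) →
    ∃ k η', Runs Q K k η η' ∧ η' out = f v ∧ ∀ x : ℕ, 2 ≤ x → x < b → x ≠ out → η' x = η x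

/-- `f` can be computed by programs with coin flips in bounded expected time. -/
def Computes {n : ℕ} (f : List.Vector ℕ n → ℕ) : Prop :=
  ∀ (ins : Fin n → ℕ) (out b : ℕ), (∀ i, 2 ≤ ins i ∧ ins i < b) → 2 ≤ out → out < b →
    ∃ Q K L, ComputesWith f ins out b Q K L

theorem computes_of_aexp {n : ℕ} {f : List.Vector ℕ n → ℕ} (e : (Fin n → ℕ) → AExp)
    (he : ∀ (ins : Fin n → ℕ) (η : Valuation) (v : List.Vector ℕ n),
      (∀ i, η (ins i) = v.get i) → (e ins).eval η = f v) : Computes f := by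
  intro ins out b _ ho _
  refine ⟨.assign out (e ins), 1, 1, stopBound_assign (by omega) _, fun η v hη hv => ?_⟩
  refine ⟨0, _, runs_assign (q := f v) hη ho ?_, by simp, fun x _ _ hx => ?_⟩
  · rw [he ins η v hv]; simp
  · exact Function.update_of_ne hx _ _

/-- The intermediate values go to the fresh variables b, ..., b + n - 1. Compiling with the bound b
+ n protects the values already computed. -/
theorem computes_comp {m n : ℕ} {f : List.Vector ℕ n → ℕ} (g : Fin n → List.Vector ℕ m → ℕ)
    (hf : Computes f) (hg : ∀ i, Computes (g i)) :
    Computes fun v => f (List.Vector.ofFn fun i => g i v) := by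
  intro ins out b hins ho hb
  have key : ∀ j ≤ n, ∃ Q K L, StopBound Q L ∧ ∀ (η : Valuation) (v : List.Vector ℕ m), η 0 = 0 →
      (∀ i, η (ins i) = v.get i) → ∃ k η', Runs Q K k η η' ∧
        (∀ i : Fin n, (i : ℕ) < j → η' (b + i : ℕ) = g i v) ∧
        ∀ x : ℕ, 2 ≤ x → x < b → η' x = η x := by
    intro j hj
    induction j with
    | zero =>
      -- The language has no empty program; an assignment to the unprotected variable b takes its
      -- place.
      refine ⟨.assign b (.const 0 0), 1, 1, stopBound_assign (by omega) _, fun η v hη _ => ?_⟩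
      refine ⟨0, _, runs_assign (q := 0) hη (by omega) (by simp [AExp.eval]), by simp, ?_⟩
      intro x _ hx
      exact Function.update_of_ne (show x ≠ b by omega) _ _
    | succ j ih =>
      obtain ⟨Q, K, L, hL, hQ⟩ := ih (by omega)
      obtain ⟨Q', K', L', hQ'⟩ := hg ⟨j, hj⟩ ins (b + j) (b + n)
        (fun i => ⟨(hins i).1, by have := (hins i).2; omega⟩) (by omega) (by omega)
      refine ⟨.seq Q Q', K + K' + L' + 2, _, hL.seq hQ'.aborted, fun η v hη hv => ?_⟩
      obtain ⟨k₁, η₁, r₁, e₁, s₁⟩ := hQ η v hη hv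
      obtain ⟨k₂, η₂, r₂, e₂, s₂⟩ := hQ'.run η₁ v r₁.flag fun i => by
        rw [s₁ _ (hins i).1 (hins i).2, hv]
      refine ⟨_, η₂, r₁.seq r₂ hQ'.aborted, fun i hi => ?_, fun x hx hxb => ?_⟩
      · by_cases h : (i : ℕ) = j
        · obtain rfl : i = ⟨j, hj⟩ := Fin.ext h
          exact e₂
        · rw [s₂ _ (by omega) (by omega) (by omega)]
          exact e₁ i (by omega)
      · rw [s₂ x hx (by omega) (by omega), s₁ x hx hxb]
  obtain ⟨Q, K, L, hL, hQ⟩ := key n le_rfl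
  obtain ⟨Q', K', L', hQ'⟩ := hf (fun i => b + i) out (b + n) (fun i => by omega) ho (by omega)
  refine ⟨.seq Q Q', K + K' + L' + 2, _, hL.seq hQ'.aborted, fun η v hη hv => ?_⟩
  obtain ⟨k₁, η₁, r₁, e₁, s₁⟩ := hQ η v hη hv
  obtain ⟨k₂, η₂, r₂, e₂, s₂⟩ := hQ'.run η₁ (List.Vector.ofFn fun i => g i v) r₁.flag fun i => by
    rw [e₁ i i.2, List.Vector.get_ofFn]
  refine ⟨_, η₂, r₁.seq r₂ hQ'.aborted, e₂, fun x hx hxb hxo => ?_⟩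
  rw [s₂ x hx (by omega) hxo, s₁ x hx hxb]

/-- The guard of a loop that counts up to the value of a variable unless it is aborted. -/
def countGuard (cnt lim : ℕ) : BExp :=
  .and (.lt (.var cnt) (.var lim)) (.eq (.var 0) (.const 0 0))

theorem countGuard_eval (cnt lim : ℕ) (η : Valuation) :
    (countGuard cnt lim).eval η = true ↔ η cnt < η lim ∧ η 0 = 0 := by
  simp [countGuard, BExp.eval, AExp.eval]

/-- Variable b accumulates the value and b + 1 counts the iterations. The result is copied to `out`
only at the end, since `out` may coincide with an input that is still needed. -/
theorem computes_prec {n : ℕ} {f : List.Vector ℕ n → ℕ} {g : List.Vector ℕ (n + 2) → ℕ}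
    (hf : Computes f) (hg : Computes g) :
    Computes fun v : List.Vector ℕ (n + 1) =>
      v.head.rec (f v.tail) fun y IH => g (y ::ᵥ IH ::ᵥ v.tail) := by
  intro ins out b hins ho hb
  obtain ⟨Qf, Kf, Lf, hQf⟩ := hf (fun i => ins i.succ) b (b + 2)
    (fun i => ⟨(hins _).1, by have := (hins i.succ).2; omega⟩) (by omega) (by omega)
  obtain ⟨Qg, Kg, Lg, hQg⟩ := hg (Fin.cons (b + 1) (Fin.cons b fun i => ins i.succ)) b (b + 2)
    (fun i => by
      refine Fin.cases ?_ (fun i => Fin.cases ?_ (fun i => ?_) i) i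
      · simp; omega
      · simp; omega
      · have := hins i.succ
        simp; omega) (by omega) (by omega)
  set incr : Prog := .assign (b + 1) (.add (.var (b + 1)) (.const 1 0))
  have hincrL : StopBound incr 1 := stopBound_assign (by simp) _
  set body : Prog := .seq Qg (.seq incr flip)
  have hguard : ∀ η : Valuation, η 0 ≠ 0 → (countGuard (b + 1) (ins 0)).eval η = false := by
    intro η hη
    rw [← Bool.not_eq_true, countGuard_eval]
    exact fun h => hη h.2
  have hloopL := stopBound_loop hguard body
  have hinitL : StopBound (.assign (b + 1) (.const 0 0)) 1 := stopBound_assign (by simp) _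
  have houtL : StopBound (.assign out (.var b)) 1 :=
    stopBound_assign (by omega) _
  -- This is the constant of `Runs.seq` for `Qg` followed by `incr; flip`; the brackets are the
  -- running bound and the abortion bound of `incr; flip`.
  let Kb := Kg + (1 + 2 + 2 + 2) + (1 + 2 + 1) + 2
  refine ⟨.seq Qf (.seq (.assign (b + 1) (.const 0 0))
      (.seq (.loop (countGuard (b + 1) (ins 0)) body) (.assign out (.var b)))),
    Kf + (1 + (2 * Kb + 8 + 1 + 1 + 2) + (1 + 1 + 1) + 2) + (1 + (1 + 1 + 1) + 1) + 2, _,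
    hQf.aborted.seq (hinitL.seq (hloopL.seq houtL)), fun η v hη hv => ?_⟩
  have ht : ∀ i : Fin n, η (ins i.succ) = v.tail.get i := fun i => by
    rw [hv, List.Vector.get_tail_succ]
  obtain ⟨k₁, η₁, r₁, e₁, s₁⟩ := hQf.run η v.tail hη ht
  set R : ℕ → ℕ := fun m => Nat.rec (f v.tail) (fun y IH => g (y ::ᵥ IH ::ᵥ v.tail)) m with hR
  set η₂ : Valuation := Function.update η₁ (b + 1 : ℕ) 0 with hη₂
  have r₂ : Runs (.assign (b + 1) (.const 0 0)) 1 0 η₁ η₂ :=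
    runs_assign r₁.flag (by omega) (by simp [AExp.eval])
  -- Loop invariant with m iterations still to go.
  let J : ℕ → Valuation → Prop := fun m η' => η' 0 = 0 ∧ ∃ y, y + m = v.head ∧
    η' (b + 1 : ℕ) = y ∧ η' b = R y ∧ ∀ x : ℕ, 2 ≤ x → x < b → η' x = η x
  have hlim : ∀ η' : Valuation, (∀ x : ℕ, 2 ≤ x → x < b → η' x = η x) →
      η' (ins 0) = v.head := fun η' h => by
    rw [h _ (hins 0).1 (hins 0).2, hv, List.Vector.get_zero]
  have hJ₂ : J v.head η₂ := by
    refine ⟨r₂.flag, 0, by omega, by simp [hη₂], ?_, fun x hx hxb => ?_⟩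
    · rw [hη₂, Function.update_of_ne (by simp), e₁]
      rfl
    · rw [hη₂, Function.update_of_ne (show x ≠ b + 1 by omega), s₁ x hx (by omega) (by omega)]
  obtain ⟨k₃, η₃, r₃, f₃, y, hy, -, e₃, s₃⟩ := runs_loop (P := body) (K := Kb)
    (b := countGuard (b + 1) (ins 0)) J hguard
    (fun η' ⟨h0, y, hy, hc, _, hs⟩ => by
      refine ⟨?_, h0⟩
      rw [← Bool.not_eq_true, countGuard_eval, hc, hlim η' hs]
      intro h
      have := Nat.cast_lt.1 h.1
      omega)
    (fun m η' ⟨h0, y, hy, hc, ha, hs⟩ => by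
      refine ⟨?_, ?_⟩
      · rw [countGuard_eval, hc, hlim η' hs]
        exact ⟨Nat.cast_lt.2 (by omega), h0⟩
      · obtain ⟨k₄, η₄, r₄, e₄, s₄⟩ := hQg.run η' (y ::ᵥ R y ::ᵥ v.tail) h0 (fun i => by
          refine Fin.cases ?_ (fun i => Fin.cases ?_ (fun i => ?_) i) i
          · simpa using hc
          · exact ha
          · simpa using (hs _ (hins _).1 (hins _).2).trans (ht i))
        have hc₄ : η₄ (b + 1 : ℕ) = y := by rw [s₄ _ (by omega) (by omega) (by omega), hc]
        have r₅ : Runs incr 1 0 η₄ (Function.update η₄ (b + 1 : ℕ) ((y + 1 : ℕ) : ℚ≥0)) :=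
          runs_assign r₄.flag (by omega) (by simp [AExp.eval, hc₄])
        refine ⟨k₄ + 0, _, (r₄.seq (r₅.seq (runs_flip r₅.flag) stopBound_flip)
          (hincrL.seq stopBound_flip)), (runs_flip r₅.flag).flag, y + 1, by omega, ?_, ?_, ?_⟩
        · rw [Function.update_of_ne (show b + 1 ≠ 1 by omega), Function.update_self]
        · rw [Function.update_of_ne (show b ≠ 1 by omega),
            Function.update_of_ne (show b ≠ b + 1 by omega), e₄]
        · intro x hx hxb
          rw [Function.update_of_ne (show x ≠ 1 by omega),
            Function.update_of_ne (show x ≠ b + 1 by omega), s₄ x hx (by omega) (by omega),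
            hs x hx hxb])
    v.head η₂ hJ₂
  obtain rfl : y = v.head := by omega
  have r₆ : Runs (.assign out (.var b)) 1 0 η₃ (Function.update η₃ out (R v.head : ℚ≥0)) :=
    runs_assign f₃ ho (by simp [AExp.eval, e₃])
  refine ⟨_, _, r₁.seq (r₂.seq (r₃.seq r₆ houtL) (hloopL.seq houtL))
    (hinitL.seq (hloopL.seq houtL)), by simp [hR], fun x hx hxb hxo => ?_⟩
  rw [Function.update_of_ne hxo, s₃ x hx hxb]

/-- The expected-time bounds do not depend on the arguments: only loops could make them grow, and
each iteration of a loop halves the chance of going on. -/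
theorem computes_of_primrec' {n : ℕ} {f : List.Vector ℕ n → ℕ} (hf : Nat.Primrec' f) :
    Computes f := by
  induction hf with
  | zero => exact computes_of_aexp (fun _ => .const 0 0) (by simp [AExp.eval])
  | succ =>
    refine computes_of_aexp (fun ins => .add (.var (ins 0)) (.const 1 0)) fun ins η v h => ?_
    simp [AExp.eval, h]
  | get i => exact computes_of_aexp (fun ins => .var (ins i)) (by simp +contextual [AExp.eval])
  | comp g _ _ hf hg => exact computes_comp g hf hg
  | prec _ _ hf hg => exact computes_prec hf hg

/-! The program whose expected time is finite if and only if a given set is finite. Its variables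
are `0` (abortion flag), `1` (cost), `2` (instance), `3` (rounded input), `4` (stage), `5` (value of
the tested function), `6` (delay) and `7` (input). -/

/-- `v := v + 1`. -/
def incr (v : Var) : Prog := .assign v (.add (.var v) (.const 1 0))

theorem ert_incr {v : Var} {m : ℕ} {η : Valuation} (h : η v = m) (g : Valuation → ℝ≥0∞) :
    (incr v).ert g η = 1 + g (Function.update η v ((m + 1 : ℕ) : ℚ≥0)) := by
  rw [incr, Prog.ert_assign, Valuation.assign_eq (q := ((m + 1 : ℕ) : ℚ≥0))]
  simp [AExp.eval, h]

/-- Round the input up. -/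
def roundUp : Prog := .loop (.lt (.var 3) (.var 7)) (incr 3)

/-- Each iteration takes three steps: guard, assignment and return to the loop. Rounding makes
arbitrary rational inputs behave like natural numbers. -/
theorem ert_roundUp (g : Valuation → ℝ≥0∞) (d m : ℕ) (η : Valuation) (hm : η 3 = m)
    (hd : m + d = ⌈η 7⌉₊) :
    roundUp.ert g η = 3 * d + 1 + g (Function.update η 3 (⌈η 7⌉₊ : ℚ≥0)) := by
  induction d generalizing m η with
  | zero =>
    have hb : (BExp.lt (.var 3) (.var 7)).eval η = false := by
      simp only [BExp.eval, AExp.eval, decide_eq_false_iff_not, NNRat.cast_lt, hm, ← Nat.lt_ceil]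
      omega
    rw [roundUp, Prog.ert_loop_of_false hb, ← hd, add_zero, ← hm, Function.update_eq_self]
    simp
  | succ d ih =>
    have hb : (BExp.lt (.var 3) (.var 7)).eval η = true := by
      simp only [BExp.eval, AExp.eval, decide_eq_true_eq, NNRat.cast_lt, hm, ← Nat.lt_ceil]
      omega
    rw [roundUp, Prog.ert_loop_of_true hb, ert_incr hm, ← roundUp, ih (m + 1) _ (by simp)
      (by simp; omega)]
    simp only [Function.update_idem, Function.update_of_ne (show (7 : ℕ) ≠ 3 by norm_num)]
    push_cast
    ring

/-- Wait for the number of steps in variable `6` unless the program is aborted. -/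
def delay : Prog :=
  .loop (.and (.lt (.const 0 0) (.var 6)) (.eq (.var 0) (.const 0 0)))
    (.assign 6 (.sub (.var 6) (.const 1 0)))

theorem ert_delay (g : Valuation → ℝ≥0∞) (u : ℕ) (η : Valuation) (h₀ : η 0 = 0) (hu : η 6 = u) :
    delay.ert g η = 3 * u + 1 + g (Function.update η 6 0) := by
  induction u generalizing η with
  | zero =>
    have hz : η 6 = 0 := by simpa using hu
    rw [delay, Prog.ert_loop_of_false (by simp [BExp.eval, AExp.eval, hz]), ← hz,
      Function.update_eq_self]
    simp
  | succ u ih =>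
    rw [delay, Prog.ert_loop_of_true
      (by simp [BExp.eval, AExp.eval, hu, h₀]; positivity), Prog.ert_assign,
      Valuation.assign_eq (q := (u : ℚ≥0)) (by simp [AExp.eval, hu]), ← delay,
      ih _ (by rwa [Function.update_of_ne (by norm_num)]) (by simp), Function.update_idem]
    push_cast
    ring

/-! ### The stages of the test program -/

/-- Wait for as long as the cost says if the value of the tested function is one, advance the stage
and flip a coin. -/
def advance : Prog :=
  .seq (.assign 6 (.mul (.var 1) (.var 5))) (.seq delay (.seq (incr 4) flip))

theorem stopBound_advance : ∃ L, StopBound advance L := by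
  have h : StopBound delay 1 := stopBound_loop (fun η hη => by simp [BExp.eval, AExp.eval, hη]) _
  have h' : StopBound (incr 4) 1 := stopBound_assign (by norm_num) _
  exact ⟨_, (stopBound_assign (by norm_num) _).seq (h.seq (h'.seq stopBound_flip))⟩

/-- The state at stage `t` with cost `C` for the instance `x` and the input `n`. -/
structure AtStage (x n t C : ℕ) (η : Valuation) : Prop where
  flag : η 0 = 0
  cost : η 1 = C
  inst : η 2 = x
  input : η 3 = n
  stage : η 4 = t

theorem ert_advance {x n t C r : ℕ} {η : Valuation} (h : AtStage x n t C η) (hr : η 5 = r) :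
    ∃ η₁ η₂ : Valuation, AtStage x n (t + 1) (2 * C) η₁ ∧ η₂ 0 ≠ 0 ∧
      ∀ g, advance.ert g η = 8 + 3 * (C * r : ℕ) + 2⁻¹ * g η₁ + 2⁻¹ * g η₂ := by
  let η' : Valuation := Function.update (Function.update (Function.update η 6 ((C * r : ℕ) : ℚ≥0))
    6 0) 4 ((t + 1 : ℕ) : ℚ≥0)
  refine ⟨Function.update η' 1 (2 * η' 1), Function.update η' 0 1, ?_, by simp, fun g => ?_⟩
  · constructor
    · simpa [η'] using h.flag
    · simp [η', h.cost]
    · simpa [η'] using h.inst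
    · simpa [η'] using h.input
    · simp [η']
  · rw [advance, Prog.ert_seq, Prog.ert_assign, Valuation.assign_eq (q := ((C * r : ℕ) : ℚ≥0))
      (by simp [AExp.eval, h.cost, hr]), Prog.ert_seq, ert_delay _ (C * r) _
      (by simpa using h.flag) (by simp), Prog.ert_seq, ert_incr (m := t) (by simpa using h.stage),
      ert_flip]
    ring

/-- The tested function takes the value of an indicator at every stage; `Q` computes it into
variable `5`. -/
structure Tests (h : List.Vector ℕ 3 → ℕ) (Q : Prog) : Prop where
  le_one : ∀ v, h v ≤ 1
  computes : ∃ K L, ComputesWith h ![2, 3, 4] 5 8 Q K L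

theorem Computes.exists_tests {h : List.Vector ℕ 3 → ℕ} (hh : Computes h) (h₁ : ∀ v, h v ≤ 1) :
    ∃ Q, Tests h Q := by
  obtain ⟨Q, K, L, hQ⟩ := hh ![2, 3, 4] 5 8 (by decide) (by norm_num) (by norm_num)
  exact ⟨Q, h₁, K, L, hQ⟩

/-- One stage. -/
def stageBody (Q : Prog) : Prog := .seq Q advance

/-- If k flips are survived while the tested function is computed, the cost has become 2^k C, and
the delay proportional to it happens with probability 2^(-k). The powers cancel, so the delay
contributes C h up to a factor 3, however large k is. The flip in `advance` makes the exponent k +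
1. -/
theorem ert_stageBody {h : List.Vector ℕ 3 → ℕ} {Q : Prog} (hQ : Tests h Q) :
    ∃ K : ℕ, ∀ (x n t C : ℕ) (η : Valuation), AtStage x n t C η → ∃ k η',
      AtStage x n (t + 1) (2 ^ (k + 1) * C) η' ∧
      (∀ g, (C * h ⟨[x, n, t], rfl⟩ : ℕ) + 2⁻¹ ^ (k + 1) * g η' ≤ (stageBody Q).ert g η) ∧
      ∀ (g : Valuation → ℝ≥0∞) (B p : ℝ≥0∞), p + 2⁻¹ ^ (k + 1) = 1 →
        (∀ η'' : Valuation, η'' 0 ≠ 0 → g η'' ≤ B) → (stageBody Q).ert g η ≤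
          K + 3 * (C * h ⟨[x, n, t], rfl⟩ : ℕ) + p * B + 2⁻¹ ^ (k + 1) * g η' := by
  obtain ⟨K, L, haborted, hrun⟩ := hQ.computes
  obtain ⟨L', hL'⟩ := stopBound_advance
  -- The constant is K for `Q`, 1 + L' for runs aborted in `Q`, and 1 + 8 for reaching `advance` and
  -- for its own overhead.
  refine ⟨K + L' + 10, fun x n t C η hη => ?_⟩
  obtain ⟨k, η₁, r₁, e₁, s₁⟩ := hrun η ⟨[x, n, t], rfl⟩ hη.flag (by
    intro i
    fin_cases i
    · exact hη.inst
    · exact hη.input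
    · exact hη.stage)
  have hA : AtStage x n t (2 ^ k * C) η₁ := by
    refine ⟨r₁.flag, by rw [r₁.cost, hη.cost]; push_cast; rfl, ?_, ?_, ?_⟩
    · rw [s₁ 2 (by norm_num) (by norm_num) (by norm_num), hη.inst]
    · rw [s₁ 3 (by norm_num) (by norm_num) (by norm_num), hη.input]
    · rw [s₁ 4 (by norm_num) (by norm_num) (by norm_num), hη.stage]
  obtain ⟨η₂, η₃, hA₂, h₃, ha⟩ := ert_advance hA e₁
  generalize h ⟨[x, n, t], rfl⟩ = r at *
  have hc : (2⁻¹ : ℝ≥0∞) ^ k * ((2 ^ k * C * r : ℕ) : ℝ≥0∞) = (C * r : ℕ) := by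
    push_cast
    rw [mul_assoc, ← mul_assoc, half_pow_mul_two_pow, one_mul]
  refine ⟨k, η₂, by rwa [pow_succ', mul_assoc], fun g => ?_, fun g B p hp hg => ?_⟩
  · rw [stageBody, Prog.ert_seq]
    refine le_trans ?_ (r₁.lower _)
    rw [ha, ← hc, pow_succ, mul_assoc (2⁻¹ ^ k), ← mul_add]
    refine mul_le_mul_right ?_ _
    calc _ ≤ ((2 ^ k * C * r : ℕ) : ℝ≥0∞) + 2⁻¹ * g η₂ +
        (9 + 2 * ((2 ^ k * C * r : ℕ) : ℝ≥0∞) + 2⁻¹ * g η₃) := le_add_right le_rfl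
      _ = _ := by ring
  · obtain ⟨p₁, e₁, l₁⟩ := exists_add_half_pow k
    have hp' : p₁ + 2⁻¹ ^ k * 2⁻¹ = p := by
      refine add_mul_eq_of_half_pow hp e₁ ?_
      rw [pow_one, ENNReal.inv_two_add_inv_two]
    rw [stageBody, Prog.ert_seq]
    have u₁ := r₁.upper (fun η' => 1 + advance.ert g η') (1 + (L' + B)) p₁ e₁
        fun η' h' => add_le_add le_rfl (hL' η' h' g B hg)
    have u₂ := hg η₃ h₃
    have q₁ := half_pow_le_one k
    rw [ha] at u₁
    rw [← hp', ← hc, pow_succ]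
    generalize (2⁻¹ : ℝ≥0∞) ^ k = a at *
    calc _ ≤ _ := u₁
      _ ≤ K + p₁ * (1 + (L' + B)) + a * (1 + (8 + 3 * ((2 ^ k * C * r : ℕ) : ℝ≥0∞) +
          2⁻¹ * g η₂ + 2⁻¹ * B)) := by gcongr
      _ = K + p₁ * (1 + L') + a * 9 + 3 * (a * ((2 ^ k * C * r : ℕ) : ℝ≥0∞)) +
          (p₁ + a * 2⁻¹) * B + a * 2⁻¹ * g η₂ := by ring
      _ ≤ K + 1 * (1 + L') + 1 * 9 + 3 * (a * ((2 ^ k * C * r : ℕ) : ℝ≥0∞)) +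
          (p₁ + a * 2⁻¹) * B + a * 2⁻¹ * g η₂ := by gcongr
      _ = _ := by push_cast; ring

/-- The guard of the loop over all stages. -/
def notAborted : BExp := .eq (.var 0) (.const 0 0)

theorem notAborted_eval (η : Valuation) : notAborted.eval η = true ↔ η 0 = 0 := by
  simp [notAborted, BExp.eval, AExp.eval]

/-- The loop over all stages. -/
def stages (Q : Prog) : Prog := .loop notAborted (stageBody Q)

/-- From one stage to the next, the cost grows by exactly the factor by which the probability of
surviving shrinks, so every positive stage contributes the same amount C. -/
theorem le_ert_stages {h : List.Vector ℕ 3 → ℕ} {Q : Prog} (hQ : Tests h Q) (x n m t C : ℕ)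
    (η : Valuation) (hη : AtStage x n t C η) :
    ((C * ∑ i ∈ Finset.range m, h ⟨[x, n, t + i], rfl⟩ : ℕ) : ℝ≥0∞) ≤ (stages Q).ert 0 η := by
  obtain ⟨K, hK⟩ := ert_stageBody hQ
  induction m generalizing t C η with
  | zero => simp
  | succ m ih =>
    obtain ⟨k, η', hη', hl, -⟩ := hK x n t C η hη
    rw [stages, Prog.ert_loop_of_true ((notAborted_eval η).2 hη.flag)]
    refine le_trans ?_ (le_add_left (hl _))
    rw [Finset.sum_range_succ', mul_add, add_comm, Nat.cast_add]
    refine add_le_add le_rfl ?_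
    refine le_trans ?_ (mul_le_mul_right (le_add_left (ih (t + 1) _ η' hη')) _)
    rw [mul_assoc, Nat.cast_mul (2 ^ (k + 1)), ← mul_assoc, Nat.cast_pow, Nat.cast_ofNat,
      half_pow_mul_two_pow, one_mul]
    simp only [add_assoc, add_comm 1]
    exact le_rfl

/-- The invariant charges 3C for each positive stage still to come, plus a constant for the
overhead. The constant X = 2(K + 4) solves 1 + K + 2 + 1 + X/2 = X, as a stage is survived with
probability at most 1/2. -/
theorem ert_stages_le {h : List.Vector ℕ 3 → ℕ} {Q : Prog} (hQ : Tests h Q) (x n : ℕ)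
    (F : Finset ℕ) (hF : ∀ t, h ⟨[x, n, t], rfl⟩ ≠ 0 → t ∈ F) (t C : ℕ) (η : Valuation)
    (hη : AtStage x n t C η) : (stages Q).ert 0 η ≠ ⊤ := by
  obtain ⟨K, hK⟩ := ert_stageBody hQ
  let N : ℕ → ℕ := fun t => (F.filter (t ≤ ·)).card
  have hN : ∀ t, h ⟨[x, n, t], rfl⟩ + N (t + 1) ≤ N t := by
    intro t
    have hsub : F.filter (t + 1 ≤ ·) ⊆ F.filter (t ≤ ·) := fun s hs => by
      simp only [Finset.mem_filter] at hs ⊢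
      exact ⟨hs.1, by omega⟩
    by_cases h0 : h ⟨[x, n, t], rfl⟩ = 0
    · rw [h0, zero_add]
      exact Finset.card_le_card hsub
    · have h1 := hQ.le_one ⟨[x, n, t], rfl⟩
      have h2 : (F.filter (t + 1 ≤ ·)).card < (F.filter (t ≤ ·)).card :=
        Finset.card_lt_card ((Finset.ssubset_iff_of_subset hsub).2
          ⟨t, by simp [hF t h0], by simp⟩)
      simp only [N]
      omega
  -- The valuation determines the stage and the cost, so the infimum merely reads them off; it is ⊤
  -- on valuations that describe no stage. An aborted run still needs one step to leave the loop.
  let I : Valuation → ℝ≥0∞ := fun η => if η 0 = 0 then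
    ⨅ (t : ℕ) (C : ℕ) (_ : AtStage x n t C η), ((2 * (K + 4) : ℕ) : ℝ≥0∞) + (3 * (C * N t) : ℕ)
    else 1
  have key : (stages Q).ert 0 η ≤ I η := by
    refine Prog.ert_loop_le (fun η hη => ?_) (fun η hη => ?_) η
    · rw [notAborted_eval] at hη
      simp only [I]
      rw [if_pos hη]
      refine le_iInf fun t => le_iInf fun C => le_iInf fun hA => ?_
      obtain ⟨k, η', hη', -, hu⟩ := hK x n t C η hA
      obtain ⟨p, hp, hp1⟩ := exists_add_half_pow (k + 1)
      have hI : I η' ≤ ((2 * (K + 4) : ℕ) : ℝ≥0∞) + (3 * (2 ^ (k + 1) * C * N (t + 1)) : ℕ) := by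
        simp only [I]
        rw [if_pos hη'.flag]
        exact iInf_le_of_le _ (iInf_le_of_le _ (iInf_le _ hη'))
      have haborted : ∀ η'' : Valuation, η'' 0 ≠ 0 → 1 + I η'' ≤ 2 := fun η'' h'' => by
        simp only [I]
        rw [if_neg h'', one_add_one_eq_two]
      have hcost : (2⁻¹ : ℝ≥0∞) ^ (k + 1) * ((3 * (2 ^ (k + 1) * C * N (t + 1)) : ℕ) : ℝ≥0∞) =
          (3 * (C * N (t + 1)) : ℕ) := by
        have : ((3 * (2 ^ (k + 1) * C * N (t + 1)) : ℕ) : ℝ≥0∞) =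
          2 ^ (k + 1) * (3 * (C * N (t + 1)) : ℕ) := by push_cast; ring
        rw [this, ← mul_assoc, half_pow_mul_two_pow, one_mul]
      have q₁ : (2⁻¹ : ℝ≥0∞) ^ (k + 1) ≤ 2⁻¹ := by
        rw [pow_succ]
        exact mul_le_of_le_one_left zero_le (half_pow_le_one k)
      have q₂ := half_pow_le_one (k + 1)
      have hh : (2⁻¹ : ℝ≥0∞) * ((2 * (K + 4) : ℕ) : ℝ≥0∞) = (K + 4 : ℕ) := by
        rw [Nat.cast_mul, ← mul_assoc, Nat.cast_ofNat, ENNReal.inv_mul_cancel (by simp) (by simp),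
          one_mul]
      have u := hu (fun η' => 1 + I η') 2 p hp haborted
      generalize (2⁻¹ : ℝ≥0∞) ^ (k + 1) = a at *
      have hsum : K + 4 + (3 * (C * h ⟨[x, n, t], rfl⟩)) + (K + 4) + 3 * (C * N (t + 1)) ≤
          2 * (K + 4) + 3 * (C * N t) := by
        have := Nat.mul_le_mul_left C (hN t)
        rw [mul_add] at this
        omega
      calc _ ≤ _ := add_le_add le_rfl u
        _ ≤ 1 + (K + 3 * (C * h ⟨[x, n, t], rfl⟩ : ℕ) + 1 * 2 + a * (1 +
            (((2 * (K + 4) : ℕ) : ℝ≥0∞) + (3 * (2 ^ (k + 1) * C * N (t + 1)) : ℕ)))) := by gcongr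
        _ = 1 + K + 3 * (C * h ⟨[x, n, t], rfl⟩ : ℕ) + 2 + a * 1 + a * ((2 * (K + 4) : ℕ) : ℝ≥0∞) +
            a * (3 * (2 ^ (k + 1) * C * N (t + 1)) : ℕ) := by ring
        _ ≤ 1 + K + 3 * (C * h ⟨[x, n, t], rfl⟩ : ℕ) + 2 + 1 * 1 +
            2⁻¹ * ((2 * (K + 4) : ℕ) : ℝ≥0∞) + a * (3 * (2 ^ (k + 1) * C * N (t + 1)) : ℕ) := by gcongr
        _ = ((K + 4 + (3 * (C * h ⟨[x, n, t], rfl⟩)) + (K + 4) + 3 * (C * N (t + 1)) : ℕ) :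
            ℝ≥0∞) := by rw [hh, hcost]; push_cast; ring
        _ ≤ ((2 * (K + 4) + 3 * (C * N t) : ℕ) : ℝ≥0∞) := by exact_mod_cast hsum
        _ = _ := by push_cast; ring
    · have h0 : η 0 ≠ 0 := fun h0 => by simp [(notAborted_eval η).2 h0] at hη
      simp [I, h0]
  refine ne_top_of_le_ne_top ?_ key
  simp only [I]
  rw [if_pos hη.flag]
  refine ne_top_of_le_ne_top ?_ (iInf_le_of_le t (iInf_le_of_le C (iInf_le _ hη)))
  exact ENNReal.add_ne_top.2 ⟨ENNReal.natCast_ne_top _, ENNReal.natCast_ne_top _⟩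

/-- The program for the instance `x`. -/
def testProg (Q : Prog) (x : ℕ) : Prog :=
  .seq (.assign 2 (.const x 0)) (.seq (.assign 3 (.const 0 0)) (.seq roundUp
    (.seq (.assign 0 (.const 0 0)) (.seq (.assign 1 (.const 1 0))
      (.seq (.assign 4 (.const 0 0)) (stages Q))))))

/-- The initialization takes a finite number of steps and sets all variables that `AtStage`
mentions. The others, in particular the work variables of `Q`, may start with arbitrary values. -/
theorem expectedTime_testProg (Q : Prog) (x : ℕ) (η : Valuation) :
    ∃ (η' : Valuation) (K : ℕ), AtStage x ⌈η 7⌉₊ 0 1 η' ∧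
      expectedTime (testProg Q x) η = K + (stages Q).ert 0 η' := by
  have hc : ∀ (m : ℕ) (η : Valuation) (v : Var),
      η.assign v (.const m 0) = Function.update η v (m : ℚ≥0) := fun m η v =>
    Valuation.assign_eq (by simp [AExp.eval]) v
  rw [expectedTime_eq_ert, testProg, Prog.ert_seq, Prog.ert_assign, Prog.ert_seq, Prog.ert_assign,
    Prog.ert_seq, ert_roundUp _ ⌈η 7⌉₊ 0 _ (by simp [hc]) (by simp [hc]), Prog.ert_seq,
    Prog.ert_assign, Prog.ert_seq, Prog.ert_assign, Prog.ert_seq, Prog.ert_assign]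
  simp only [hc, Function.update_of_ne (show (7 : ℕ) ≠ 2 by norm_num),
    Function.update_of_ne (show (7 : ℕ) ≠ 3 by norm_num)]
  refine ⟨Function.update (Function.update (Function.update (Function.update (Function.update
    (Function.update η 2 (x : ℚ≥0)) 3 ((0 : ℕ) : ℚ≥0)) 3 (⌈η 7⌉₊ : ℚ≥0)) 0 ((0 : ℕ) : ℚ≥0))
    1 ((1 : ℕ) : ℚ≥0)) 4 ((0 : ℕ) : ℚ≥0), 3 * ⌈η 7⌉₊ + 12, ?_, ?_⟩
  · constructor <;> simp
  · push_cast
    ring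

theorem testProg_mem_UPAST_iff {h : List.Vector ℕ 3 → ℕ} {Q : Prog} (hQ : Tests h Q) (x : ℕ) :
    testProg Q x ∈ UPAST ↔ ∀ n, {t | h ⟨[x, n, t], rfl⟩ ≠ 0}.Finite := by
  constructor
  · intro hx n
    by_contra hinf
    -- Any valuation with n in variable 7 would do.
    have hn := hx fun _ => (n : ℚ≥0)
    obtain ⟨η', K, hA, e⟩ := expectedTime_testProg Q x fun _ => (n : ℚ≥0)
    rw [Nat.ceil_natCast] at hA
    rw [PAST, e, lt_top_iff_ne_top] at hn
    refine hn (ENNReal.add_eq_top.2 (Or.inr (ENNReal.eq_top_of_forall_nnreal_le fun r => ?_)))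
    obtain ⟨M, hM⟩ := exists_nat_ge r
    obtain ⟨S, hS, hcard⟩ := Set.Infinite.exists_subset_card_eq hinf M
    -- Enough stages to pass every element of a set of M positive stages.
    have hle := le_ert_stages hQ x n (S.sup id + 1) 0 1 η' hA
    refine le_trans ?_ hle
    have hsub : S ⊆ Finset.range (S.sup id + 1) := fun s hs => by
      rw [Finset.mem_range]
      exact Nat.lt_succ_of_le (Finset.le_sup (f := id) hs)
    have hsum : M ≤ 1 * ∑ i ∈ Finset.range (S.sup id + 1), h ⟨[x, n, 0 + i], rfl⟩ := by
      rw [one_mul, ← hcard, Finset.card_eq_sum_ones]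
      refine le_trans (Finset.sum_le_sum fun i hi => ?_) (Finset.sum_le_sum_of_subset hsub)
      have := hS hi
      rw [zero_add]
      exact Nat.one_le_iff_ne_zero.2 this
    calc (r : ℝ≥0∞) ≤ M := by exact_mod_cast hM
      _ ≤ _ := by exact_mod_cast hsum
  · intro hfin η
    obtain ⟨η', K, hA, e⟩ := expectedTime_testProg Q x η
    rw [PAST, e, lt_top_iff_ne_top, ENNReal.add_ne_top]
    refine ⟨ENNReal.natCast_ne_top _, ?_⟩
    exact ert_stages_le hQ x _ (hfin _).toFinset (fun t ht => by simpa using ht) 0 1 η' hA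

/-! Hardness. -/

/-- The first `i` universal statements `∀ j, r (m, j)` are refuted one after the other. -/
def refuteAll (r : ℕ → ℕ → Bool) (i : ℕ) : Part ℕ :=
  Nat.rec (Part.some 0) (fun m IH => IH.bind fun _ => Nat.rfind fun j => Part.some !r m j) i

theorem refuteAll_dom (r : ℕ → ℕ → Bool) (i : ℕ) :
    (refuteAll r i).Dom ↔ ∀ m < i, ∃ j, r m j = false := by
  induction i with
  | zero => simp [refuteAll]
  | succ i ih =>
    have e : refuteAll r (i + 1) =
      (refuteAll r i).bind fun _ => Nat.rfind fun j => Part.some !r i j := rfl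
    rw [e, Part.bind_dom]
    have h : (Nat.rfind fun j => Part.some !r i j).Dom ↔ ∃ j, r i j = false := by
      refine Nat.rfind_dom.trans ?_
      simp
    simp only [ih, h, exists_prop, Nat.forall_lt_succ_right]

/-- The domain is an initial segment of ℕ; it is proper exactly when some m cannot be refuted. -/
theorem finite_refuteAll_dom (r : ℕ → ℕ → Bool) :
    {i | (refuteAll r i).Dom}.Finite ↔ ∃ m, ∀ j, r m j = true := by
  simp only [refuteAll_dom]
  constructor
  · intro h
    by_contra! hn
    refine h.not_infinite (Set.infinite_univ.mono fun i _ m _ => ?_)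
    obtain ⟨j, hj⟩ := hn m
    exact ⟨j, by simpa using hj⟩
  · rintro ⟨m, hm⟩
    refine (Set.finite_le_nat m).subset fun i hi => ?_
    by_contra hlt
    obtain ⟨j, hj⟩ := hi m (by simpa using hlt)
    simp [hm] at hj

theorem partrec_refuteAll {Y : Type} [Primcodable Y] {r : Y × List ℕ → Bool} (hr : Computable r) :
    Partrec fun a : Y × ℕ × ℕ => refuteAll (fun m j => r (a.1, [a.2.1, m, j])) a.2.2 := by
  have hl : Primrec fun q : ((Y × ℕ × ℕ) × ℕ × ℕ) × ℕ => (q.1.1.1, [q.1.1.2.1, q.1.2.1, q.2]) :=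
    Primrec.pair (Primrec.fst.comp (Primrec.fst.comp Primrec.fst))
      (Primrec.list_cons.comp
        (Primrec.fst.comp (Primrec.snd.comp (Primrec.fst.comp Primrec.fst)))
        (Primrec.list_cons.comp (Primrec.fst.comp (Primrec.snd.comp Primrec.fst))
          (Primrec.list_cons.comp Primrec.snd (Primrec.const []))))
  have hs : Partrec₂ fun (a : Y × ℕ × ℕ) (q : ℕ × ℕ) =>
      Nat.rfind fun j => Part.some !r (a.1, [a.2.1, q.1, j]) :=
    Partrec.rfind (Primrec.not.to_comp.comp (hr.comp hl.to_comp)).partrec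
  exact Partrec.nat_rec (Primrec.snd.comp Primrec.snd).to_comp (Computable.const 0).partrec hs

/-! ### Halting with exact fuel -/

open Nat.Partrec in
/-- Whether the code `c` halts on input `m` with fuel `k + 1` but not with fuel `k`. -/
def haltsAt (c : Code) (m k : ℕ) : Bool := (c.evaln (k + 1) m).isSome && !(c.evaln k m).isSome

open Nat.Partrec in
theorem exists_haltsAt_iff (c : Code) (m : ℕ) : (∃ k, haltsAt c m k = true) ↔ (c.eval m).Dom := by
  simp only [haltsAt, Bool.and_eq_true, Option.isSome_iff_exists, Bool.not_eq_true',
    Option.isSome_eq_false_iff, Option.isNone_iff_eq_none]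
  constructor
  · rintro ⟨k, ⟨a, ha⟩, -⟩
    exact Part.dom_iff_mem.2 ⟨a, Code.evaln_sound ha⟩
  · intro h
    have hex : ∃ k, (c.evaln k m).isSome := by
      obtain ⟨a, ha⟩ := Part.dom_iff_mem.1 h
      obtain ⟨k, hk⟩ := Code.evaln_complete.1 ha
      exact ⟨k, Option.isSome_iff_exists.2 ⟨a, hk⟩⟩
    classical
    -- With fuel 0 nothing halts, so the least sufficient fuel is a successor.
    obtain ⟨k, hk⟩ : ∃ k, Nat.find hex = k + 1 := by
      refine Nat.exists_eq_succ_of_ne_zero fun h0 => ?_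
      have := Nat.find_spec hex
      rw [h0] at this
      simp [Code.evaln] at this
    refine ⟨k, Option.isSome_iff_exists.1 (hk ▸ Nat.find_spec hex), ?_⟩
    have := Nat.find_min hex (m := k) (by omega)
    simpa using this

open Nat.Partrec in
theorem haltsAt_unique {c : Code} {m k k' : ℕ} (h : haltsAt c m k = true)
    (h' : haltsAt c m k' = true) : k = k' := by
  have key : ∀ {k k' : ℕ}, haltsAt c m k = true → haltsAt c m k' = true → ¬ k < k' := by
    intro k k' h h' hlt
    simp only [haltsAt, Bool.and_eq_true, Option.isSome_iff_exists, Bool.not_eq_true',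
      Option.isSome_eq_false_iff, Option.isNone_iff_eq_none] at h h'
    obtain ⟨a, ha⟩ := h.1
    have := Code.evaln_mono (Nat.succ_le_of_lt hlt) ha
    rw [h'.2] at this
    cases this
  have h₁ := key h h'
  have h₂ := key h' h
  omega

open Nat.Partrec in
-- Projecting t = (i, k) to i maps the set onto the domain, and injectively, because the exact fuel
-- is unique.
theorem finite_haltsAt_iff (c : Code) (f : ℕ → ℕ) :
    {t : ℕ | haltsAt c (f t.unpair.1) t.unpair.2 = true}.Finite ↔
      {i | (c.eval (f i)).Dom}.Finite := by
  have himage : (fun t : ℕ => t.unpair.1) '' {t : ℕ | haltsAt c (f t.unpair.1) t.unpair.2 = true} =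
      {i | (c.eval (f i)).Dom} := by
    ext i
    simp only [Set.mem_image, Set.mem_ofPred_eq, ← exists_haltsAt_iff]
    constructor
    · rintro ⟨t, ht, rfl⟩
      exact ⟨_, ht⟩
    · rintro ⟨k, hk⟩
      exact ⟨Nat.pair i k, by simpa using hk, by simp⟩
  rw [← himage, Set.finite_image_iff]
  intro t ht t' ht' e
  have e : t.unpair.1 = t'.unpair.1 := e
  simp only [Set.mem_ofPred_eq] at ht ht'
  rw [← Nat.pair_unpair t, ← Nat.pair_unpair t', e]
  rw [e] at ht
  rw [haltsAt_unique ht ht']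

open Nat.Partrec in
theorem primrec_haltsAt (c : Code) : Primrec₂ (haltsAt c) := by
  have h : Primrec₂ fun m k => (c.evaln k m).isSome :=
    Primrec.option_isSome.comp (Code.primrec_evaln.comp
      (Primrec.pair (Primrec.pair Primrec.snd (Primrec.const c)) Primrec.fst))
  exact Primrec.and.comp (h.comp Primrec.fst (Primrec.succ.comp Primrec.snd)) (Primrec.not.comp h)

open Nat.Partrec in
/-- The function tested by the reduction. -/
def haltsTest (c : Code) (v : List.Vector ℕ 3) : ℕ :=
  cond (haltsAt c (Nat.pair (v.get 0) (Nat.pair (v.get 1) (v.get 2).unpair.1)) (v.get 2).unpair.2)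
    1 0

open Nat.Partrec in
theorem primrec_haltsTest (c : Code) : Nat.Primrec' (haltsTest c) := by
  refine Nat.Primrec'.of_prim ?_
  have hg : ∀ i : Fin 3, Primrec fun v : List.Vector ℕ 3 => v.get i := fun i =>
    Primrec.vector_get.comp Primrec.id (Primrec.const i)
  have hu := Primrec.unpair.comp (hg 2)
  exact Primrec.cond ((primrec_haltsAt c).comp
    (Primrec₂.natPair.comp (hg 0) (Primrec₂.natPair.comp (hg 1) (Primrec.fst.comp hu)))
    (Primrec.snd.comp hu)) (Primrec.const 1) (Primrec.const 0)

/-- The instance enters the program only as one constant in its first assignment, so its code is an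
explicit pairing expression in x. -/
theorem primrec_testProg (Q : Prog) : Primrec (testProg Q) := by
  rw [← Primrec.encode_iff]
  have e : (fun x => Encodable.encode (testProg Q x)) = fun x =>
      4 * Nat.pair (4 * Nat.pair 2 (5 * Nat.pair x 0)) (Encodable.encode (Prog.seq
        (.assign 3 (.const 0 0)) (.seq roundUp (.seq (.assign 0 (.const 0 0))
          (.seq (.assign 1 (.const 1 0)) (.seq (.assign 4 (.const 0 0)) (stages Q))))))) + 1 := rfl
  rw [e]
  have hm : ∀ {f : ℕ → ℕ} (m : ℕ), Primrec f → Primrec fun x => m * f x := fun m hf =>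
    Primrec.nat_mul.comp (Primrec.const m) hf
  refine Primrec.succ.comp (hm 4 (Primrec₂.natPair.comp (hm 4 (Primrec₂.natPair.comp
    (Primrec.const 2) (hm 5 (Primrec₂.natPair.comp Primrec.id (Primrec.const 0)))))
    (Primrec.const _)))

theorem isPiHard_UPAST : IsPiHard 3 UPAST := by
  rintro Y _ C ⟨R, hR, hC⟩
  obtain ⟨r, hr, rfl⟩ := ComputablePred.computable_iff.1 hR
  -- One code serves all instances: it receives the encoding of (y, n, i).
  obtain ⟨c, hc⟩ := Nat.Partrec.Code.exists_code.1 (partrec_refuteAll hr)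
  obtain ⟨Q, hQ⟩ := (computes_of_primrec' (primrec_haltsTest c)).exists_tests fun v => by
    rw [haltsTest]
    cases haltsAt c _ _ <;> simp
  refine ⟨fun y => testProg Q (Encodable.encode y),
    (primrec_testProg Q).to_comp.comp Computable.encode, fun y => ?_⟩
  change y ∈ C ↔ testProg Q (Encodable.encode y) ∈ UPAST
  rw [hC, testProg_mem_UPAST_iff hQ]
  refine forall_congr' fun n => ?_
  have h₁ : {t | haltsTest c ⟨[Encodable.encode y, n, t], rfl⟩ ≠ 0} = {t : ℕ | haltsAt c
      (Nat.pair (Encodable.encode y) (Nat.pair n t.unpair.1)) t.unpair.2 = true} := by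
    ext t
    simp only [haltsTest, Set.mem_ofPred_eq]
    change cond (haltsAt c (Nat.pair (Encodable.encode y) (Nat.pair n t.unpair.1)) t.unpair.2)
      1 0 ≠ 0 ↔ _
    cases haltsAt c _ _ <;> simp
  have h₂ : ∀ i, (c.eval (Nat.pair (Encodable.encode y) (Nat.pair n i))).Dom ↔
      (refuteAll (fun m j => r (y, [n, m, j])) i).Dom := fun i => by
    have : Nat.pair (Encodable.encode y) (Nat.pair n i) = Encodable.encode (y, n, i) := by simp
    rw [hc, this]
    simp
  rw [h₁, finite_haltsAt_iff c fun i => Nat.pair (Encodable.encode y) (Nat.pair n i)]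
  simp only [h₂, finite_refuteAll_dom]
  rfl

/-! The expected time depends only on the variables of the program. -/

/-- A strict upper bound for the variables of an arithmetical expression. -/
def AExp.bound : AExp → ℕ
  | const _ _ => 0
  | var v => v + 1
  | add e₁ e₂ => max e₁.bound e₂.bound
  | sub e₁ e₂ => max e₁.bound e₂.bound
  | mul e₁ e₂ => max e₁.bound e₂.bound

/-- A strict upper bound for the variables of a Boolean expression. -/
def BExp.bound : BExp → ℕ
  | eq e₁ e₂ => max e₁.bound e₂.bound
  | lt e₁ e₂ => max e₁.bound e₂.bound
  | not b => b.bound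
  | and b₁ b₂ => max b₁.bound b₂.bound
  | or b₁ b₂ => max b₁.bound b₂.bound

/-- A strict upper bound for the variables of a program. -/
def Prog.bound : Prog → ℕ
  | assign v e => max (v + 1) e.bound
  | seq P Q => max P.bound Q.bound
  | choice _ P Q => max P.bound Q.bound
  | loop b P => max b.bound P.bound

/-- A strict upper bound for the variables of a remainder. -/
def Ctrl.bound : Ctrl → ℕ
  | done => 0
  | prog P => P.bound
  | seq c P => max c.bound P.bound

/-- Agreement of valuations below `N`. -/
def Agree (N : ℕ) (η η' : Valuation) : Prop := ∀ v : ℕ, v < N → η v = η' v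

theorem AExp.eval_congr {N : ℕ} {η η' : Valuation} (h : Agree N η η') (e : AExp)
    (he : e.bound ≤ N) : e.eval η = e.eval η' := by
  induction e with
  | const n d => rfl
  | var v => simp only [AExp.eval, h v he]
  | add a b iha ihb | sub a b iha ihb | mul a b iha ihb =>
    simp only [AExp.bound, max_le_iff] at he
    simp only [AExp.eval, iha he.1, ihb he.2]

theorem BExp.eval_congr {N : ℕ} {η η' : Valuation} (h : Agree N η η') (b : BExp)
    (hb : b.bound ≤ N) : b.eval η = b.eval η' := by
  induction b with
  | eq a b | lt a b =>
    simp only [BExp.bound, max_le_iff] at hb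
    simp only [BExp.eval, AExp.eval_congr h _ hb.1, AExp.eval_congr h _ hb.2]
  | not b ih => simp only [BExp.eval, ih hb]
  | and a b iha ihb | or a b iha ihb =>
    simp only [BExp.bound, max_le_iff] at hb
    simp only [BExp.eval, iha hb.1, ihb hb.2]

/-- Outcomes that agree below `N` and use no other variables. -/
structure Outcome.Agree (N : ℕ) (o o' : Outcome) : Prop where
  weight : o.weight = o'.weight
  ctrl : o.ctrl = o'.ctrl
  bound : o.ctrl.bound ≤ N
  val : PGCL.Agree N o.val o'.val

theorem forall₂_andThen {N : ℕ} {l l' : List Outcome} (h : List.Forall₂ (Outcome.Agree N) l l')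
    (Q : Prog) (hQ : Q.bound ≤ N) : List.Forall₂ (Outcome.Agree N) (l.map (Outcome.andThen Q))
      (l'.map (Outcome.andThen Q)) := by
  rw [List.forall₂_map_left_iff, List.forall₂_map_right_iff]
  refine h.imp fun o o' ho => ⟨ho.weight, ?_, max_le ho.bound hQ, ho.val⟩
  simp [Outcome.andThen, ho.ctrl]

theorem Prog.succs_congr {N : ℕ} {η η' : Valuation} (h : Agree N η η') (P : Prog)
    (hP : P.bound ≤ N) : List.Forall₂ (Outcome.Agree N) (P.succs η) (P.succs η') := by
  induction P with
  | assign v e =>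
    simp only [Prog.bound, max_le_iff] at hP
    refine .cons ⟨rfl, rfl, Nat.zero_le _, fun x hx => ?_⟩ .nil
    -- In this form the value of `e` can be rewritten without a nonnegativity proof depending on it.
    have hA : ∀ η : Valuation, η.assign v e = Function.update η v (e.eval η).toNNRat :=
      fun _ => rfl
    simp only [hA, AExp.eval_congr h e hP.2]
    by_cases hxv : x = v
    · subst hxv; simp
    · rw [Function.update_of_ne hxv, Function.update_of_ne hxv, h x hx]
  | seq P Q ih _ =>
    simp only [Prog.bound, max_le_iff] at hP
    exact forall₂_andThen (ih hP.1) Q hP.2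
  | choice p P Q _ _ =>
    simp only [Prog.bound, max_le_iff] at hP
    exact .cons ⟨rfl, rfl, hP.1, h⟩ (.cons ⟨rfl, rfl, hP.2, h⟩ .nil)
  | loop b P _ =>
    have hP' := hP
    simp only [Prog.bound, max_le_iff] at hP
    rw [Prog.succs, Prog.succs, BExp.eval_congr h b hP.1]
    split_ifs
    · exact .cons ⟨rfl, rfl, max_le hP.2 hP', h⟩ .nil
    · exact .cons ⟨rfl, rfl, Nat.zero_le _, h⟩ .nil

theorem Ctrl.succs_congr {N : ℕ} {η η' : Valuation} (h : Agree N η η') (c : Ctrl)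
    (hc : c.bound ≤ N) : List.Forall₂ (Outcome.Agree N) (c.succs η) (c.succs η') := by
  induction c with
  | done => exact .nil
  | prog P => exact Prog.succs_congr h P hc
  | seq c P ih =>
    simp only [Ctrl.bound, max_le_iff] at hc
    by_cases hd : c = .done
    · subst hd
      exact .cons ⟨rfl, rfl, hc.2, h⟩ .nil
    · rw [Ctrl.succs_seq hd, Ctrl.succs_seq hd]
      exact forall₂_andThen (ih hc.1) P hc.2

/-- Steps on agreeing valuations give the same weights and remainders and again agreeing valuations,
and no remainder acquires new variables. -/
theorem survive_congr {N : ℕ} (k : ℕ) {η η' : Valuation} (h : Agree N η η') (c : Ctrl)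
    (hc : c.bound ≤ N) : survive k c η = survive k c η' := by
  induction k generalizing c η η' with
  | zero => rfl
  | succ k ih =>
    rw [survive, survive]
    congr 1
    have hs := Ctrl.succs_congr h c hc
    generalize c.succs η = l at hs
    generalize c.succs η' = l' at hs
    induction hs with
    | nil => rfl
    | cons ho _ ihl =>
      rw [List.map_cons, List.map_cons, ihl, ho.weight, ih ho.val _ ho.bound, ho.ctrl]

/-! Expected times as limits of computable rational numbers. -/

/-- Finiteness of a series of nonnegative terms is boundedness of its partial sums, which gives the
quantifiers ∃∀. -/
theorem PAST_iff (P : Prog) (η : Valuation) :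
    PAST P η ↔ ∃ N : ℕ, ∀ n, ∑ k ∈ Finset.range n, survive k (.prog P) η ≤ N := by
  have key : ∀ (N : ℕ) (q : ℚ), ENNReal.ofReal (q : ℝ) ≤ (N : ℝ≥0∞) ↔ q ≤ N := fun N q => by
    rw [← ENNReal.ofReal_natCast, ENNReal.ofReal_le_ofReal_iff (Nat.cast_nonneg N)]
    norm_cast
  rw [PAST, expectedTime_eq_iSup]
  simp only [← key, ← ertWithin_zero_eq]
  constructor
  · intro h
    obtain ⟨N, hN⟩ := ENNReal.exists_nat_gt h.ne
    exact ⟨N, fun n => (le_iSup _ n).trans hN.le⟩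
  · rintro ⟨N, hN⟩
    exact lt_of_le_of_lt (iSup_le hN) (ENNReal.natCast_lt_top N)

/-- The nonnegative rational number with a given code. -/
def fracVal (w : ℕ × ℕ) : ℚ≥0 := (w.1 : ℚ≥0) / ((w.2 : ℚ≥0) + 1)

/-- The valuation given by a list of variables and codes of their values. -/
def envVal (env : List (ℕ × ℕ × ℕ)) : Valuation := fun v => fracVal ((env.lookup v).getD (0, 0))

theorem lookup_map_of_mem {β : Type} (f : ℕ → β) {l : List ℕ} {v : ℕ} (h : v ∈ l) :
    (l.map fun k => (k, f k)).lookup v = some (f v) := by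
  induction l with
  | nil => simp at h
  | cons a l ih =>
    rw [List.map_cons, List.lookup_cons]
    by_cases hv : v = a
    · subst hv; simp
    · rw [beq_false_of_ne hv]
      exact ih (by simpa [hv] using h)

theorem exists_env (N : ℕ) (η : Valuation) : ∃ env, Agree N η (envVal env) := by
  -- A code (a, d) denotes a / (d + 1), hence the denominator is lowered by one.
  refine ⟨(List.range N).map fun v => (v, (η v).num, (η v).den - 1), fun v hv => ?_⟩
  have hd : ((η v).den - 1 : ℕ) + 1 = (η v).den := Nat.succ_pred_eq_of_pos (η v).den_pos
  rw [envVal, lookup_map_of_mem (fun v => ((η v).num, (η v).den - 1)) (List.mem_range.2 hv),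
    Option.getD_some, fracVal]
  simp only [← Nat.cast_add_one, hd]
  exact (NNRat.num_div_den (η v)).symm

theorem mem_UPAST_iff (P : Prog) : P ∈ UPAST ↔ ∀ env : List (ℕ × ℕ × ℕ), ∃ N : ℕ, ∀ n,
    ∑ k ∈ Finset.range n, survive k (.prog P) (envVal env) ≤ N := by
  simp only [UPAST, Set.mem_ofPred_eq, PAST_iff]
  refine ⟨fun h env => h _, fun h η => ?_⟩
  obtain ⟨env, he⟩ := exists_env P.bound η
  simp only [fun k => survive_congr k he (.prog P) le_rfl]
  exact h env

/-! ### Rational arithmetic and evaluation on codes -/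

/-- The rational number with a given code. -/
def ratVal (q : ℕ × ℕ × ℕ) : ℚ := ((q.1 : ℚ) - q.2.1) / ((q.2.2 : ℚ) + 1)

/-- Addition of codes of rational numbers. -/
def ratAdd (q r : ℕ × ℕ × ℕ) : ℕ × ℕ × ℕ :=
  (q.1 * (r.2.2 + 1) + r.1 * (q.2.2 + 1), q.2.1 * (r.2.2 + 1) + r.2.1 * (q.2.2 + 1),
    q.2.2 * r.2.2 + q.2.2 + r.2.2)

/-- Subtraction of codes of rational numbers. -/
def ratSub (q r : ℕ × ℕ × ℕ) : ℕ × ℕ × ℕ := ratAdd q (r.2.1, r.1, r.2.2)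

/-- Multiplication of codes of rational numbers. -/
def ratMul (q r : ℕ × ℕ × ℕ) : ℕ × ℕ × ℕ :=
  (q.1 * r.1 + q.2.1 * r.2.1, q.1 * r.2.1 + q.2.1 * r.1, q.2.2 * r.2.2 + q.2.2 + r.2.2)

/-- The left-hand side of the comparison of two rational numbers after multiplication by their
denominators. -/
def ratCross (q r : ℕ × ℕ × ℕ) : ℕ := q.1 * (r.2.2 + 1) + r.2.1 * (q.2.2 + 1)

/-- The third component d d' + d + d' is (d + 1)(d' + 1) - 1, the stored form of the product of the
denominators. -/
theorem ratVal_add (q r : ℕ × ℕ × ℕ) : ratVal (ratAdd q r) = ratVal q + ratVal r := by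
  have h₁ : (q.2.2 : ℚ) + 1 ≠ 0 := by positivity
  have h₂ : (r.2.2 : ℚ) + 1 ≠ 0 := by positivity
  have h₃ : (q.2.2 * r.2.2 + q.2.2 + r.2.2 : ℚ) + 1 ≠ 0 := by positivity
  simp only [ratVal, ratAdd]
  push_cast
  field_simp
  ring

theorem ratVal_sub (q r : ℕ × ℕ × ℕ) : ratVal (ratSub q r) = ratVal q - ratVal r := by
  rw [ratSub, ratVal_add]
  simp only [ratVal]
  ring

theorem ratVal_mul (q r : ℕ × ℕ × ℕ) : ratVal (ratMul q r) = ratVal q * ratVal r := by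
  have h₁ : (q.2.2 : ℚ) + 1 ≠ 0 := by positivity
  have h₂ : (r.2.2 : ℚ) + 1 ≠ 0 := by positivity
  have h₃ : (q.2.2 * r.2.2 + q.2.2 + r.2.2 : ℚ) + 1 ≠ 0 := by positivity
  simp only [ratVal, ratMul]
  push_cast
  field_simp
  ring

theorem ratVal_eq_iff (q r : ℕ × ℕ × ℕ) : ratVal q = ratVal r ↔ ratCross q r = ratCross r q := by
  rw [ratVal, ratVal, div_eq_div_iff (by positivity) (by positivity),
    ← Nat.cast_inj (R := ℚ), ratCross, ratCross]
  push_cast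
  constructor <;> intro h <;> linarith

theorem ratVal_lt_iff (q r : ℕ × ℕ × ℕ) : ratVal q < ratVal r ↔ ratCross q r < ratCross r q := by
  rw [ratVal, ratVal, div_lt_div_iff₀ (by positivity) (by positivity),
    ← Nat.cast_lt (α := ℚ), ratCross, ratCross]
  push_cast
  constructor <;> intro h <;> linarith

/-- Evaluation of arithmetical expressions on codes. -/
def AExp.evalCode (env : List (ℕ × ℕ × ℕ)) : AExp → ℕ × ℕ × ℕ
  | const n d => (n, 0, d)
  | var v => (((env.lookup v).getD (0, 0)).1, 0, ((env.lookup v).getD (0, 0)).2)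
  | add a b => ratAdd (a.evalCode env) (b.evalCode env)
  | sub a b => ratSub (a.evalCode env) (b.evalCode env)
  | mul a b => ratMul (a.evalCode env) (b.evalCode env)

theorem AExp.ratVal_evalCode (env : List (ℕ × ℕ × ℕ)) (e : AExp) :
    ratVal (e.evalCode env) = e.eval (envVal env) := by
  induction e with
  | const n d => simp [AExp.evalCode, AExp.eval, ratVal]
  | var v => simp [AExp.evalCode, AExp.eval, ratVal, envVal, fracVal]
  | add a b iha ihb => rw [AExp.evalCode, AExp.eval, ratVal_add, iha, ihb]
  | sub a b iha ihb => rw [AExp.evalCode, AExp.eval, ratVal_sub, iha, ihb]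
  | mul a b iha ihb => rw [AExp.evalCode, AExp.eval, ratVal_mul, iha, ihb]

/-- Evaluation of Boolean expressions on codes. -/
def BExp.evalCode (env : List (ℕ × ℕ × ℕ)) : BExp → Bool
  | eq a b => decide (ratCross (a.evalCode env) (b.evalCode env) =
      ratCross (b.evalCode env) (a.evalCode env))
  | lt a b => decide (ratCross (a.evalCode env) (b.evalCode env) <
      ratCross (b.evalCode env) (a.evalCode env))
  | not b => !b.evalCode env
  | and a b => a.evalCode env && b.evalCode env
  | or a b => a.evalCode env || b.evalCode env

theorem BExp.evalCode_eq (env : List (ℕ × ℕ × ℕ)) (b : BExp) :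
    b.evalCode env = b.eval (envVal env) := by
  induction b with
  | eq a b => simp only [BExp.evalCode, BExp.eval, ← AExp.ratVal_evalCode, ratVal_eq_iff]
  | lt a b => simp only [BExp.evalCode, BExp.eval, ← AExp.ratVal_evalCode, ratVal_lt_iff]
  | not b ih => rw [BExp.evalCode, BExp.eval, ih]
  | and a b iha ihb => rw [BExp.evalCode, BExp.eval, iha, ihb]
  | or a b iha ihb => rw [BExp.evalCode, BExp.eval, iha, ihb]

/-! ### Execution of programs on codes -/

/-- Codes of weighted configurations: the weight, the remaining programs, where the first one may be
absent, and the valuation. -/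
abbrev Config : Type := (ℕ × ℕ) × (Option Prog × List Prog) × List (ℕ × ℕ × ℕ)

/-- The remainder of a configuration. -/
def toCtrl (s : Option Prog × List Prog) : Ctrl := s.2.foldl Ctrl.seq (s.1.elim .done .prog)

/-- What a configuration stands for. -/
def Config.interp (o : Config) : ℚ × Ctrl × Valuation := (fracVal o.1, toCtrl o.2.1, envVal o.2.2)

/-- Multiplication of codes of nonnegative rational numbers. -/
def fracMul (w z : ℕ × ℕ) : ℕ × ℕ := (w.1 * z.1, w.2 * z.2 + w.2 + z.2)

/-- Addition of codes of nonnegative rational numbers. -/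
def fracAdd (w z : ℕ × ℕ) : ℕ × ℕ :=
  (w.1 * (z.2 + 1) + z.1 * (w.2 + 1), w.2 * z.2 + w.2 + z.2)

theorem fracVal_mul (w z : ℕ × ℕ) : fracVal (fracMul w z) = fracVal w * fracVal z := by
  simp only [fracVal, fracMul]
  rw [div_mul_div_comm]
  push_cast
  congr 1
  ring

theorem fracVal_add (w z : ℕ × ℕ) : fracVal (fracAdd w z) = fracVal w + fracVal z := by
  simp only [fracVal, fracAdd]
  rw [div_add_div _ _ (by positivity) (by positivity)]
  push_cast
  congr 1 <;> ring

/-- Continue a configuration with further programs and multiply its weight. -/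
def Config.continueWith (w : ℕ × ℕ) (ks : List Prog) (o : Config) : Config :=
  (fracMul w o.1, (o.2.1.1, o.2.1.2 ++ ks), o.2.2)

/-- One step of a program on configurations. -/
def Prog.succConfigs (env : List (ℕ × ℕ × ℕ)) : Prog → List Config
  | assign v e => [((1, 0), (none, []),
      (v, (e.evalCode env).1 - (e.evalCode env).2.1, (e.evalCode env).2.2) :: env)]
  | seq P Q => (P.succConfigs env).map (Config.continueWith (1, 0) [Q])
  | choice p P Q => [((p.num, p.den - 1), (some P, []), env),
      ((p.den - p.num, p.den - 1), (some Q, []), env)]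
  | loop b P => if b.evalCode env then [((1, 0), (some (.seq P (.loop b P)), []), env)]
      else [((1, 0), (none, []), env)]

/-- One step of a configuration. -/
def Config.succs (o : Config) : List Config :=
  o.2.1.1.elim (o.2.1.2.head?.elim [] fun Q => [(o.1, (some Q, o.2.1.2.tail), o.2.2)]) fun P =>
    (P.succConfigs o.2.2).map (Config.continueWith o.1 o.2.1.2)

theorem envVal_cons (v : ℕ) (q : ℕ × ℕ) (env : List (ℕ × ℕ × ℕ)) :
    envVal ((v, q) :: env) = Function.update (envVal env) v (fracVal q) := by
  funext x
  by_cases h : x = v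
  · subst h; simp [envVal]
  · rw [Function.update_of_ne h]
    simp [envVal, List.lookup_cons, beq_false_of_ne h]

/-- Truncated subtraction of natural numbers performs the truncation at 0 in the semantics of
assignments. -/
theorem fracVal_sub (q : ℕ × ℕ × ℕ) : ((fracVal (q.1 - q.2.1, q.2.2) : ℚ≥0) : ℚ) =
    max (ratVal q) 0 := by
  have hd : (0 : ℚ) < (q.2.2 : ℚ) + 1 := by positivity
  simp only [fracVal, ratVal, NNRat.cast_div, NNRat.cast_add, NNRat.cast_natCast, NNRat.cast_one]
  rcases le_total q.2.1 q.1 with h | h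
  · have h' : (q.2.1 : ℚ) ≤ q.1 := by exact_mod_cast h
    rw [max_eq_left (div_nonneg (sub_nonneg.2 h') hd.le), Nat.cast_sub h]
  · have h' : (q.1 : ℚ) ≤ q.2.1 := by exact_mod_cast h
    rw [max_eq_right (div_nonpos_of_nonpos_of_nonneg (sub_nonpos.2 h') hd.le),
      Nat.sub_eq_zero_of_le h]
    simp

theorem toCtrl_append (s : Option Prog × List Prog) (ks : List Prog) :
    toCtrl (s.1, s.2 ++ ks) = ks.foldl Ctrl.seq (toCtrl s) := by
  simp [toCtrl]

/-- An outcome without its word, with its weight multiplied by `w`, and continued with `ks`. -/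
def Outcome.strip (w : ℚ) (ks : List Prog) (o : Outcome) : ℚ × Ctrl × Valuation :=
  (w * o.weight, ks.foldl Ctrl.seq o.ctrl, o.val)

theorem UnitFrac.fracVal_eq (p : UnitFrac) : ((fracVal (p.num, p.den - 1) : ℚ≥0) : ℚ) = p.val := by
  have : ((p.den - 1 : ℕ) : ℚ) + 1 = p.den := by exact_mod_cast Nat.succ_pred_eq_of_pos p.den_pos
  simp only [fracVal, UnitFrac.val, NNRat.cast_div, NNRat.cast_add, NNRat.cast_natCast,
    NNRat.cast_one]
  rw [this]

theorem UnitFrac.fracVal_eq' (p : UnitFrac) :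
    ((fracVal (p.den - p.num, p.den - 1) : ℚ≥0) : ℚ) = 1 - p.val := by
  have : ((p.den - 1 : ℕ) : ℚ) + 1 = p.den := by exact_mod_cast Nat.succ_pred_eq_of_pos p.den_pos
  have h : (p.den : ℚ) ≠ 0 := by exact_mod_cast p.den_pos.ne'
  simp only [fracVal, UnitFrac.val, NNRat.cast_div, NNRat.cast_add, NNRat.cast_natCast,
    NNRat.cast_one]
  rw [this, Nat.cast_sub p.num_le, sub_div, div_self h]

theorem Config.interp_continueWith (w : ℕ × ℕ) (ks : List Prog) (o : Config) :
    (o.continueWith w ks).interp =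
      (fracVal w * o.interp.1, ks.foldl Ctrl.seq o.interp.2.1, o.interp.2.2) := by
  simp [Config.interp, Config.continueWith, fracVal_mul, toCtrl_append]

theorem fracVal_one : fracVal (1, 0) = 1 := by simp [fracVal]

theorem Prog.map_interp_succConfigs (env : List (ℕ × ℕ × ℕ)) (P : Prog) :
    (P.succConfigs env).map Config.interp = (P.succs (envVal env)).map (Outcome.strip 1 []) := by
  induction P with
  | assign v e =>
    have h : fracVal ((e.evalCode env).1 - (e.evalCode env).2.1, (e.evalCode env).2.2) =
        (⟨max (e.eval (envVal env)) 0, le_max_right _ _⟩ : ℚ≥0) := by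
      ext
      rw [fracVal_sub, AExp.ratVal_evalCode]
      rfl
    simp [Prog.succConfigs, Prog.succs, Config.interp, Outcome.strip, toCtrl, fracVal_one,
      envVal_cons, Valuation.assign, h]
  | seq P Q ih _ =>
    have e₁ : Config.interp ∘ Config.continueWith (1, 0) [Q] =
        (fun x : ℚ × Ctrl × Valuation => (x.1, .seq x.2.1 Q, x.2.2)) ∘ Config.interp := by
      funext o
      simp [Config.interp_continueWith, fracVal_one]
    rw [Prog.succConfigs, Prog.succs, List.map_map, e₁, ← List.map_map, ih, List.map_map,
      List.map_map]
    rfl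
  | choice p P Q _ _ =>
    simp [Prog.succConfigs, Prog.succs, Config.interp, Outcome.strip, toCtrl,
      UnitFrac.fracVal_eq, UnitFrac.fracVal_eq']
  | loop b P _ =>
    rw [Prog.succConfigs, Prog.succs, BExp.evalCode_eq]
    split_ifs
    · simp [Config.interp, Outcome.strip, toCtrl, fracVal_one]
    · simp [Config.interp, Outcome.strip, toCtrl, fracVal_one]

/-- A step only affects the innermost remainder. This is why nested remainders may be stored as a
head with a flat list of pending programs. -/
theorem Ctrl.map_strip_succs_foldl {c : Ctrl} (hc : c ≠ .done) (η : Valuation) (w : ℚ)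
    (ks : List Prog) : ((ks.foldl Ctrl.seq c).succs η).map (Outcome.strip w []) =
      (c.succs η).map (Outcome.strip w ks) := by
  induction ks generalizing c with
  | nil => rfl
  | cons Q ks ih =>
    rw [List.foldl_cons, ih (by simp), Ctrl.succs_seq hc, List.map_map]
    rfl

theorem Config.map_interp_succs (o : Config) : o.succs.map Config.interp =
    (o.interp.2.1.succs o.interp.2.2).map (Outcome.strip o.interp.1 []) := by
  obtain ⟨w, ⟨h, ks⟩, env⟩ := o
  cases h with
  | none =>
    cases ks with
    | nil => rfl
    | cons Q ks =>
      have e : Config.interp (w, (none, Q :: ks), env) =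
        ((fracVal w : ℚ), ks.foldl Ctrl.seq (.seq .done Q), envVal env) := rfl
      rw [e, Ctrl.map_strip_succs_foldl (by simp)]
      simp [Config.succs, Ctrl.succs, Outcome.strip, Config.interp, toCtrl]
  | some P =>
    have e : Config.interp (w, (some P, ks), env) =
      ((fracVal w : ℚ), ks.foldl Ctrl.seq (.prog P), envVal env) := rfl
    have e₁ : Config.interp ∘ Config.continueWith w ks = (fun x : ℚ × Ctrl × Valuation =>
        ((fracVal w : ℚ) * x.1, ks.foldl Ctrl.seq x.2.1, x.2.2)) ∘ Config.interp := by
      funext o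
      simp [Config.interp_continueWith]
    have e₂ : Config.succs (w, (some P, ks), env) =
      (P.succConfigs env).map (Config.continueWith w ks) := rfl
    rw [e, Ctrl.map_strip_succs_foldl (by simp), e₂, List.map_map, e₁, ← List.map_map,
      Prog.map_interp_succConfigs, List.map_map]
    refine List.map_congr_left fun o _ => ?_
    simp [Outcome.strip]

/-- The weighted survival probability of a configuration. -/
def Config.survive (k : ℕ) (o : Config) : ℚ := o.interp.1 * PGCL.survive k o.interp.2.1 o.interp.2.2

theorem Config.sum_survive_succs (k : ℕ) (o : Config) :
    (o.succs.map (Config.survive k)).sum = o.survive (k + 1) := by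
  have e : Config.survive k =
    (fun x : ℚ × Ctrl × Valuation => x.1 * PGCL.survive k x.2.1 x.2.2) ∘ Config.interp := rfl
  rw [e, ← List.map_map, Config.map_interp_succs, List.map_map, Config.survive, PGCL.survive,
    ← List.sum_map_mul_left]
  congr 1
  refine List.map_congr_left fun x _ => ?_
  simp [Outcome.strip, mul_assoc]

/-- The total weight of the configurations in which something remains to be executed. -/
def totalWeight (l : List Config) : ℕ × ℕ :=
  l.foldr (fun o z => bif o.2.1.1.isNone && o.2.1.2.isEmpty then z else fracAdd o.1 z) (0, 0)

theorem toCtrl_eq_done_iff (s : Option Prog × List Prog) :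
    toCtrl s = .done ↔ (s.1.isNone && s.2.isEmpty) = true := by
  obtain ⟨h, ks⟩ := s
  have key : ∀ (ks : List Prog) (c : Ctrl), ks.foldl Ctrl.seq c = .done ↔ c = .done ∧ ks = [] := by
    intro ks
    induction ks with
    | nil => simp
    | cons Q ks ih => simp [ih]
  rw [toCtrl, key]
  cases h <;> simp

theorem fracVal_totalWeight (l : List Config) :
    ((fracVal (totalWeight l) : ℚ≥0) : ℚ) = (l.map (Config.survive 0)).sum := by
  induction l with
  | nil => simp [totalWeight, fracVal]
  | cons o l ih =>
    rw [List.map_cons, List.sum_cons, ← ih, totalWeight, List.foldr_cons, ← totalWeight,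
      Config.survive, PGCL.survive]
    cases h : o.2.1.1.isNone && o.2.1.2.isEmpty with
    | true =>
      have := (toCtrl_eq_done_iff o.2.1).2 h
      simp [Config.interp, this, Ctrl.running]
    | false =>
      have := Ctrl.running_of_ne (mt (toCtrl_eq_done_iff o.2.1).1 (by simp [h]))
      simp [Config.interp, this, fracVal_add]

/-- One step of all configurations, together with the accumulated total weights. -/
def timeStep (s : List Config × ℕ × ℕ) : List Config × ℕ × ℕ :=
  (s.1.flatMap Config.succs, fracAdd s.2 (totalWeight s.1))

theorem sum_survive_flatMap (k : ℕ) (l : List Config) :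
    ((l.flatMap Config.succs).map (Config.survive k)).sum =
      (l.map (Config.survive (k + 1))).sum := by
  induction l with
  | nil => rfl
  | cons o l ih =>
    rw [List.flatMap_cons, List.map_append, List.sum_append, Config.sum_survive_succs, ih,
      List.map_cons, List.sum_cons]

/-- Survival for k + 1 steps from some configurations is survival for k steps from their successors,
so the total weight running after k steps is the k-th survival probability. -/
theorem fracVal_timeStep_iterate (n : ℕ) (s : List Config × ℕ × ℕ) :
    ((fracVal (timeStep^[n] s).2 : ℚ≥0) : ℚ) =
      fracVal s.2 + ∑ k ∈ Finset.range n, (s.1.map (Config.survive k)).sum := by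
  induction n generalizing s with
  | zero => simp
  | succ n ih =>
    rw [Function.iterate_succ_apply, ih, Finset.sum_range_succ']
    simp only [timeStep, sum_survive_flatMap, fracVal_add, NNRat.cast_add, fracVal_totalWeight]
    ring

/-- The initial data for the computation of the expected time. -/
def timeInit (P : Prog) (env : List (ℕ × ℕ × ℕ)) : List Config × ℕ × ℕ :=
  ([((1, 0), (some P, []), env)], (0, 0))

/-- Clearing the denominator leaves a comparison of computable natural numbers, the matrix of the
∀∃∀ formula. -/
theorem sum_survive_le_iff (P : Prog) (env : List (ℕ × ℕ × ℕ)) (n N : ℕ) :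
    ∑ k ∈ Finset.range n, survive k (.prog P) (envVal env) ≤ N ↔
      (timeStep^[n] (timeInit P env)).2.1 ≤ N * ((timeStep^[n] (timeInit P env)).2.2 + 1) := by
  have h := fracVal_timeStep_iterate n (timeInit P env)
  generalize (timeStep^[n] (timeInit P env)).2 = q at *
  have e : ∑ k ∈ Finset.range n, survive k (.prog P) (envVal env) = (fracVal q : ℚ) := by
    rw [h]
    simp [timeInit, Config.survive, Config.interp, toCtrl, fracVal]
  rw [e, fracVal]
  push_cast
  rw [div_le_iff₀ (by positivity)]
  norm_cast

/-! Primitive recursiveness of the evaluation functions. -/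

/-- Course-of-values recursion; `g` sees only the list of earlier values and recovers the argument
as its length. -/
theorem primrec₂_of_strong_rec {α σ : Type} [Primcodable α] [Primcodable σ] {f : α → ℕ → σ}
    (g : α → List σ → σ) (hg : Primrec₂ g) (H : ∀ a n, g a ((List.range n).map (f a)) = f a n) :
    Primrec₂ f :=
  Primrec.nat_strong_rec f (g := fun a l => some (g a l)) (Primrec.option_some.comp hg)
    fun a n => by rw [H]

theorem getD_map_range {σ : Type} (f : ℕ → σ) {i n : ℕ} (h : i < n) (d : σ) :
    ((List.range n).map f).getD i d = f i := by
  simp [List.getD, h]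

section Arithmetic

variable {α : Type} [Primcodable α]

theorem primrec_ratAdd : Primrec₂ ratAdd := by
  have q₁ : Primrec fun p : (ℕ × ℕ × ℕ) × ℕ × ℕ × ℕ => p.1.1 := Primrec.fst.comp Primrec.fst
  have q₂ : Primrec fun p : (ℕ × ℕ × ℕ) × ℕ × ℕ × ℕ => p.1.2.1 :=
    Primrec.fst.comp (Primrec.snd.comp Primrec.fst)
  have q₃ : Primrec fun p : (ℕ × ℕ × ℕ) × ℕ × ℕ × ℕ => p.1.2.2 :=
    Primrec.snd.comp (Primrec.snd.comp Primrec.fst)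
  have r₁ : Primrec fun p : (ℕ × ℕ × ℕ) × ℕ × ℕ × ℕ => p.2.1 := Primrec.fst.comp Primrec.snd
  have r₂ : Primrec fun p : (ℕ × ℕ × ℕ) × ℕ × ℕ × ℕ => p.2.2.1 :=
    Primrec.fst.comp (Primrec.snd.comp Primrec.snd)
  have r₃ : Primrec fun p : (ℕ × ℕ × ℕ) × ℕ × ℕ × ℕ => p.2.2.2 :=
    Primrec.snd.comp (Primrec.snd.comp Primrec.snd)
  exact Primrec.pair (Primrec.nat_add.comp (Primrec.nat_mul.comp q₁ (Primrec.succ.comp r₃))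
      (Primrec.nat_mul.comp r₁ (Primrec.succ.comp q₃)))
    (.pair (Primrec.nat_add.comp (Primrec.nat_mul.comp q₂ (Primrec.succ.comp r₃))
      (Primrec.nat_mul.comp r₂ (Primrec.succ.comp q₃)))
    (Primrec.nat_add.comp (Primrec.nat_add.comp (Primrec.nat_mul.comp q₃ r₃) q₃) r₃))

theorem primrec_ratSub : Primrec₂ ratSub :=
  primrec_ratAdd.comp Primrec.fst (.pair (Primrec.fst.comp (Primrec.snd.comp Primrec.snd))
    (.pair (Primrec.fst.comp Primrec.snd) (Primrec.snd.comp (Primrec.snd.comp Primrec.snd))))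

theorem primrec_ratMul : Primrec₂ ratMul := by
  have q₁ : Primrec fun p : (ℕ × ℕ × ℕ) × ℕ × ℕ × ℕ => p.1.1 := Primrec.fst.comp Primrec.fst
  have q₂ : Primrec fun p : (ℕ × ℕ × ℕ) × ℕ × ℕ × ℕ => p.1.2.1 :=
    Primrec.fst.comp (Primrec.snd.comp Primrec.fst)
  have q₃ : Primrec fun p : (ℕ × ℕ × ℕ) × ℕ × ℕ × ℕ => p.1.2.2 :=
    Primrec.snd.comp (Primrec.snd.comp Primrec.fst)
  have r₁ : Primrec fun p : (ℕ × ℕ × ℕ) × ℕ × ℕ × ℕ => p.2.1 := Primrec.fst.comp Primrec.snd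
  have r₂ : Primrec fun p : (ℕ × ℕ × ℕ) × ℕ × ℕ × ℕ => p.2.2.1 :=
    Primrec.fst.comp (Primrec.snd.comp Primrec.snd)
  have r₃ : Primrec fun p : (ℕ × ℕ × ℕ) × ℕ × ℕ × ℕ => p.2.2.2 :=
    Primrec.snd.comp (Primrec.snd.comp Primrec.snd)
  exact Primrec.pair
    (Primrec.nat_add.comp (Primrec.nat_mul.comp q₁ r₁) (Primrec.nat_mul.comp q₂ r₂))
    (.pair (Primrec.nat_add.comp (Primrec.nat_mul.comp q₁ r₂) (Primrec.nat_mul.comp q₂ r₁))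
    (Primrec.nat_add.comp (Primrec.nat_add.comp (Primrec.nat_mul.comp q₃ r₃) q₃) r₃))

theorem primrec_ratCross : Primrec₂ ratCross :=
  Primrec.nat_add.comp
    (Primrec.nat_mul.comp (Primrec.fst.comp Primrec.fst)
      (Primrec.succ.comp (Primrec.snd.comp (Primrec.snd.comp Primrec.snd))))
    (Primrec.nat_mul.comp (Primrec.fst.comp (Primrec.snd.comp Primrec.snd))
      (Primrec.succ.comp (Primrec.snd.comp (Primrec.snd.comp Primrec.fst))))

theorem primrec_fracMul : Primrec₂ fracMul := by
  have q₂ : Primrec fun p : (ℕ × ℕ) × ℕ × ℕ => p.1.2 := Primrec.snd.comp Primrec.fst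
  have r₂ : Primrec fun p : (ℕ × ℕ) × ℕ × ℕ => p.2.2 := Primrec.snd.comp Primrec.snd
  exact Primrec.pair
    (Primrec.nat_mul.comp (Primrec.fst.comp Primrec.fst) (Primrec.fst.comp Primrec.snd))
    (Primrec.nat_add.comp (Primrec.nat_add.comp (Primrec.nat_mul.comp q₂ r₂) q₂) r₂)

theorem primrec_fracAdd : Primrec₂ fracAdd := by
  have q₂ : Primrec fun p : (ℕ × ℕ) × ℕ × ℕ => p.1.2 := Primrec.snd.comp Primrec.fst
  have r₂ : Primrec fun p : (ℕ × ℕ) × ℕ × ℕ => p.2.2 := Primrec.snd.comp Primrec.snd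
  exact Primrec.pair (Primrec.nat_add.comp
      (Primrec.nat_mul.comp (Primrec.fst.comp Primrec.fst) (Primrec.succ.comp r₂))
      (Primrec.nat_mul.comp (Primrec.fst.comp Primrec.snd) (Primrec.succ.comp q₂)))
    (Primrec.nat_add.comp (Primrec.nat_add.comp (Primrec.nat_mul.comp q₂ r₂) q₂) r₂)

theorem primrecPred_mod_eq {f : α → ℕ} (hf : Primrec f) (m r : ℕ) :
    PrimrecPred fun a => f a % m = r :=
  Primrec.eq.comp (Primrec.nat_mod.comp hf (Primrec.const m)) (Primrec.const r)

theorem primrec_unpair_div_fst {f : α → ℕ} (hf : Primrec f) (m : ℕ) :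
    Primrec fun a => (f a / m).unpair.1 :=
  Primrec.fst.comp (Primrec.unpair.comp (Primrec.nat_div.comp hf (Primrec.const m)))

theorem primrec_unpair_div_snd {f : α → ℕ} (hf : Primrec f) (m : ℕ) :
    Primrec fun a => (f a / m).unpair.2 :=
  Primrec.snd.comp (Primrec.unpair.comp (Primrec.nat_div.comp hf (Primrec.const m)))

end Arithmetic

theorem primrec_AExp_evalCode :
    Primrec₂ fun (env : List (ℕ × ℕ × ℕ)) (n : ℕ) => (AExp.ofNat n).evalCode env := by
  let get : List (ℕ × ℕ × ℕ) → ℕ → ℕ × ℕ × ℕ := fun l i => l.getD i (0, 0, 0)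
  refine primrec₂_of_strong_rec (fun env l =>
    if l.length % 5 = 0 then ((l.length / 5).unpair.1, 0, (l.length / 5).unpair.2)
    else if l.length % 5 = 1 then (((env.lookup (l.length / 5)).getD (0, 0)).1, 0,
      ((env.lookup (l.length / 5)).getD (0, 0)).2)
    else if l.length % 5 = 2 then
      ratAdd (get l (l.length / 5).unpair.1) (get l (l.length / 5).unpair.2)
    else if l.length % 5 = 3 then
      ratSub (get l (l.length / 5).unpair.1) (get l (l.length / 5).unpair.2)
    else ratMul (get l (l.length / 5).unpair.1) (get l (l.length / 5).unpair.2)) ?_ ?_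
  · have hl : Primrec fun p : List (ℕ × ℕ × ℕ) × List (ℕ × ℕ × ℕ) => p.2.length :=
      Primrec.list_length.comp Primrec.snd
    have h₁ := primrec_unpair_div_fst hl 5
    have h₂ := primrec_unpair_div_snd hl 5
    have g₁ := (Primrec.list_getD (0, 0, 0)).comp Primrec.snd h₁
    have g₂ := (Primrec.list_getD (0, 0, 0)).comp Primrec.snd h₂
    have hv := Primrec.option_getD.comp (Primrec.listLookup.comp
      (Primrec.nat_div.comp hl (Primrec.const 5)) Primrec.fst) (Primrec.const ((0, 0) : ℕ × ℕ))
    exact Primrec.ite (primrecPred_mod_eq hl 5 0) (.pair h₁ (.pair (.const 0) h₂))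
      (Primrec.ite (primrecPred_mod_eq hl 5 1)
        (.pair (Primrec.fst.comp hv) (.pair (.const 0) (Primrec.snd.comp hv)))
      (Primrec.ite (primrecPred_mod_eq hl 5 2) (primrec_ratAdd.comp g₁ g₂)
      (Primrec.ite (primrecPred_mod_eq hl 5 3) (primrec_ratSub.comp g₁ g₂)
        (primrec_ratMul.comp g₁ g₂))))
  · intro env n
    conv_rhs => rw [AExp.ofNat]
    simp only [List.length_map, List.length_range]
    -- The components of an expression have smaller codes, so their values are found in the list.
    split_ifs with h0 h1 h2 h3 hz hz hz
    all_goals first | rfl | omega | skip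
    all_goals
      have b₁ : (n / 5).unpair.1 < n := lt_of_le_of_lt (Nat.unpair_left_le _) (by omega)
      have b₂ : (n / 5).unpair.2 < n := lt_of_le_of_lt (Nat.unpair_right_le _) (by omega)
      simp only [get, getD_map_range _ b₁, getD_map_range _ b₂, AExp.evalCode]

theorem primrec_BExp_evalCode :
    Primrec₂ fun (env : List (ℕ × ℕ × ℕ)) (n : ℕ) => (BExp.ofNat n).evalCode env := by
  let get : List Bool → ℕ → Bool := fun l i => l.getD i false
  refine primrec₂_of_strong_rec (fun env l =>
    if l.length % 5 = 0 then
      decide (ratCross ((AExp.ofNat (l.length / 5).unpair.1).evalCode env)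
        ((AExp.ofNat (l.length / 5).unpair.2).evalCode env) =
          ratCross ((AExp.ofNat (l.length / 5).unpair.2).evalCode env)
            ((AExp.ofNat (l.length / 5).unpair.1).evalCode env))
    else if l.length % 5 = 1 then
      decide (ratCross ((AExp.ofNat (l.length / 5).unpair.1).evalCode env)
        ((AExp.ofNat (l.length / 5).unpair.2).evalCode env) <
          ratCross ((AExp.ofNat (l.length / 5).unpair.2).evalCode env)
            ((AExp.ofNat (l.length / 5).unpair.1).evalCode env))
    else if l.length % 5 = 2 then !get l (l.length / 5)
    else if l.length % 5 = 3 then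
      get l (l.length / 5).unpair.1 && get l (l.length / 5).unpair.2
    else get l (l.length / 5).unpair.1 || get l (l.length / 5).unpair.2) ?_ ?_
  · have hl : Primrec fun p : List (ℕ × ℕ × ℕ) × List Bool => p.2.length :=
      Primrec.list_length.comp Primrec.snd
    have h₁ := primrec_unpair_div_fst hl 5
    have h₂ := primrec_unpair_div_snd hl 5
    have g₀ := (Primrec.list_getD false).comp Primrec.snd (Primrec.nat_div.comp hl (.const 5))
    have g₁ := (Primrec.list_getD false).comp Primrec.snd h₁
    have g₂ := (Primrec.list_getD false).comp Primrec.snd h₂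
    have e₁ := primrec_AExp_evalCode.comp Primrec.fst h₁
    have e₂ := primrec_AExp_evalCode.comp Primrec.fst h₂
    have c₁ := primrec_ratCross.comp e₁ e₂
    have c₂ := primrec_ratCross.comp e₂ e₁
    exact Primrec.ite (primrecPred_mod_eq hl 5 0) (Primrec.eq.decide.comp c₁ c₂)
      (Primrec.ite (primrecPred_mod_eq hl 5 1) (Primrec.nat_lt.decide.comp c₁ c₂)
      (Primrec.ite (primrecPred_mod_eq hl 5 2) (Primrec.not.comp g₀)
      (Primrec.ite (primrecPred_mod_eq hl 5 3) (Primrec.and.comp g₁ g₂)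
        (Primrec.or.comp g₁ g₂))))
  · intro env n
    conv_rhs => rw [BExp.ofNat]
    simp only [List.length_map, List.length_range]
    split_ifs with h0 h1 h2 h3 hz hz hz
    all_goals first | rfl | omega | skip
    all_goals
      have b₀ : n / 5 < n := by omega
      have b₁ : (n / 5).unpair.1 < n := lt_of_le_of_lt (Nat.unpair_left_le _) b₀
      have b₂ : (n / 5).unpair.2 < n := lt_of_le_of_lt (Nat.unpair_right_le _) b₀
      simp only [get, getD_map_range _ b₀, getD_map_range _ b₁, getD_map_range _ b₂,
        BExp.evalCode]

theorem Prog.primrec_ofNat : Primrec Prog.ofNat :=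
  (Primrec.ofNat Prog).of_eq fun _ => Denumerable.ofNat_of_decode rfl

theorem Config.primrec_continueWith {α : Type} [Primcodable α] {w : α → ℕ × ℕ}
    {ks : α → List Prog} {o : α → Config} (hw : Primrec w) (hk : Primrec ks) (ho : Primrec o) :
    Primrec fun a => (o a).continueWith (w a) (ks a) := by
  have hs := Primrec.fst.comp (Primrec.snd.comp ho)
  exact Primrec.pair (primrec_fracMul.comp hw (Primrec.fst.comp ho))
    (.pair (.pair (Primrec.fst.comp hs) (Primrec.list_append.comp (Primrec.snd.comp hs) hk))
      (Primrec.snd.comp (Primrec.snd.comp ho)))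

theorem primrec_list_singleton {α β : Type} [Primcodable α] [Primcodable β] {f : α → β}
    (hf : Primrec f) : Primrec fun a => [f a] :=
  Primrec.list_cons.comp hf (Primrec.const [])

theorem primrec_succConfigs :
    Primrec₂ fun (env : List (ℕ × ℕ × ℕ)) (n : ℕ) => (Prog.ofNat n).succConfigs env := by
  let k : List (List Config) → ℕ := fun l => l.length / 4
  let p : List (List Config) → UnitFrac := fun l => UnitFrac.ofNat (k l).unpair.1
  refine primrec₂_of_strong_rec (fun env l =>
    if l.length % 4 = 0 then
      [((1, 0), (none, []), ((k l).unpair.1,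
        ((AExp.ofNat (k l).unpair.2).evalCode env).1 -
          ((AExp.ofNat (k l).unpair.2).evalCode env).2.1,
        ((AExp.ofNat (k l).unpair.2).evalCode env).2.2) :: env)]
    else if l.length % 4 = 1 then
      (l.getD (k l).unpair.1 []).map (Config.continueWith (1, 0) [Prog.ofNat (k l).unpair.2])
    else if l.length % 4 = 2 then
      [(((p l).num, (p l).den - 1), (some (Prog.ofNat (k l).unpair.2.unpair.1), []), env),
        (((p l).den - (p l).num, (p l).den - 1),
          (some (Prog.ofNat (k l).unpair.2.unpair.2), []), env)]
    else if (BExp.ofNat (k l).unpair.1).evalCode env = true then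
      -- The unrolled loop has a larger code than the loop, but only the program itself is needed,
      -- not its successors. It is rebuilt from its code, where `l.length` is the code of the loop.
      [((1, 0), (some (Prog.ofNat (4 * Nat.pair (k l).unpair.2 l.length + 1)), []), env)]
    else [((1, 0), (none, []), env)]) ?_ ?_
  · have henv : Primrec fun q : List (ℕ × ℕ × ℕ) × List (List Config) => q.1 := Primrec.fst
    have hl : Primrec fun q : List (ℕ × ℕ × ℕ) × List (List Config) => q.2.length :=
      Primrec.list_length.comp Primrec.snd
    have h₁ := primrec_unpair_div_fst hl 4
    have h₂ := primrec_unpair_div_snd hl 4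
    have h₃ := Primrec.unpair.comp h₂
    have e := primrec_AExp_evalCode.comp Primrec.fst h₂
    have u := Primrec.unpair.comp (Primrec.succ.comp h₁)
    have hn : Primrec fun q : List (ℕ × ℕ × ℕ) × List (List Config) => (p q.2).num :=
      Primrec.fst.comp u
    have hd : Primrec fun q : List (ℕ × ℕ × ℕ) × List (List Config) => (p q.2).den :=
      Primrec.nat_add.comp (Primrec.fst.comp u) (Primrec.snd.comp u)
    have hd' := Primrec.pred.comp hd
    have hnil : Primrec fun _ : List (ℕ × ℕ × ℕ) × List (List Config) => ([] : List Prog) :=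
      Primrec.const []
    have hone : Primrec fun _ : List (ℕ × ℕ × ℕ) × List (List Config) => ((1, 0) : ℕ × ℕ) :=
      Primrec.const (1, 0)
    have hnone : Primrec fun _ : List (ℕ × ℕ × ℕ) × List (List Config) =>
      ((none, []) : Option Prog × List Prog) := Primrec.const (none, [])
    have hsome : ∀ {f : List (ℕ × ℕ × ℕ) × List (List Config) → ℕ}, Primrec f →
        Primrec fun q => ((some (Prog.ofNat (f q)), []) : Option Prog × List Prog) := fun hf =>
      .pair (Primrec.option_some.comp (Prog.primrec_ofNat.comp hf)) hnil
    refine Primrec.ite (primrecPred_mod_eq hl 4 0) (primrec_list_singleton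
        (.pair hone (.pair hnone (Primrec.list_cons.comp (.pair h₁ (.pair (Primrec.nat_sub.comp
          (Primrec.fst.comp e) (Primrec.fst.comp (Primrec.snd.comp e)))
          (Primrec.snd.comp (Primrec.snd.comp e)))) henv))))
      (Primrec.ite (primrecPred_mod_eq hl 4 1) (Primrec.list_map
        ((Primrec.list_getD []).comp Primrec.snd h₁) (Config.primrec_continueWith
          (Primrec.const (1, 0)) (primrec_list_singleton
            (Prog.primrec_ofNat.comp (h₂.comp Primrec.fst))) Primrec.snd))
      (Primrec.ite (primrecPred_mod_eq hl 4 2) (Primrec.list_cons.comp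
          (.pair (.pair hn hd') (.pair (hsome (Primrec.fst.comp h₃)) henv))
          (primrec_list_singleton (.pair (.pair (Primrec.nat_sub.comp hd hn) hd')
            (.pair (hsome (Primrec.snd.comp h₃)) henv))))
      (Primrec.ite (Primrec.eq.comp (primrec_BExp_evalCode.comp henv h₁) (Primrec.const true))
        (primrec_list_singleton (.pair hone (.pair (hsome (Primrec.succ.comp
          (Primrec.nat_mul.comp (Primrec.const 4) (Primrec₂.natPair.comp h₂ hl)))) henv)))
        (primrec_list_singleton (.pair hone (.pair hnone henv))))))
  · intro env n
    simp only [p, k, List.length_map, List.length_range]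
    have hn := Prog.ofNat.eq_1 n
    split_ifs at hn with h0 hz h1 h2
    · rw [if_pos h0, hn]; rfl
    · omega
    · have b₁ : (n / 4).unpair.1 < n := lt_of_le_of_lt (Nat.unpair_left_le _) (by omega)
      rw [if_neg h0, if_pos h1, hn, getD_map_range _ b₁, Prog.succConfigs]
    · rw [if_neg h0, if_neg h1, if_pos h2, hn, Prog.succConfigs]
    · have hloop : Prog.ofNat (4 * Nat.pair (n / 4).unpair.2 n + 1) =
          .seq (Prog.ofNat (n / 4).unpair.2) (Prog.ofNat n) := by
        rw [← Prog.ofNat_toNat (.seq (Prog.ofNat (n / 4).unpair.2) (Prog.ofNat n)), Prog.toNat,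
          Prog.toNat_ofNat, Prog.toNat_ofNat]
      rw [if_neg h0, if_neg h1, if_neg h2, hloop, hn, Prog.succConfigs]

theorem Config.primrec_succs : Primrec Config.succs := by
  have hP : Primrec₂ fun (o : Config) (P : Prog) => P.succConfigs o.2.2 :=
    (primrec_succConfigs.comp (Primrec.snd.comp (Primrec.snd.comp Primrec.fst))
      (Primrec.encode.comp Primrec.snd)).of_eq fun q => by
        rw [show Prog.ofNat (Encodable.encode q.2) = q.2 from Prog.ofNat_toNat q.2]
  have hs : Primrec fun o : Config => o.2.1.2 :=
    Primrec.snd.comp (Primrec.fst.comp Primrec.snd)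
  have h₀ : Primrec₂ fun (o : Config) (Q : Prog) =>
      ([(o.1, (some Q, o.2.1.2.tail), o.2.2)] : List Config) := by
    have ht : Primrec fun p : Config × Prog => p.1.2.1.2.tail :=
      Primrec.list_tail.comp (hs.comp Primrec.fst)
    have hq : Primrec fun p : Config × Prog => some p.2 := Primrec.option_some.comp Primrec.snd
    have he : Primrec fun p : Config × Prog => p.1.2.2 :=
      Primrec.snd.comp (Primrec.snd.comp Primrec.fst)
    have hw : Primrec fun p : Config × Prog => p.1.1 := Primrec.fst.comp Primrec.fst
    exact primrec_list_singleton (hw.pair ((hq.pair ht).pair he))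
  have hhead : Primrec fun o : Config => o.2.1.2.head? := Primrec.list_head?.comp hs
  have h₁ : Primrec fun o : Config =>
      o.2.1.2.head?.elim ([] : List Config) fun Q => [(o.1, (some Q, o.2.1.2.tail), o.2.2)] :=
    (Primrec.option_casesOn hhead (Primrec.const []) h₀).of_eq fun o => by
      cases o.2.1.2.head? <;> rfl
  have h₂ : Primrec₂ fun (o : Config) (P : Prog) =>
      (P.succConfigs o.2.2).map (Config.continueWith o.1 o.2.1.2) :=
    Primrec.list_map hP (Config.primrec_continueWith
      (Primrec.fst.comp (Primrec.fst.comp Primrec.fst)) (hs.comp (Primrec.fst.comp Primrec.fst))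
      Primrec.snd)
  refine (Primrec.option_casesOn (Primrec.fst.comp (Primrec.fst.comp Primrec.snd)) h₁ h₂).of_eq
    fun o => ?_
  rw [Config.succs]
  cases o.2.1.1 <;> rfl

theorem primrec_totalWeight : Primrec totalWeight := by
  have hs : Primrec fun p : List Config × Config × ℕ × ℕ => p.2.1.2.1 :=
    Primrec.fst.comp (Primrec.snd.comp (Primrec.fst.comp Primrec.snd))
  have h₁ : Primrec fun p : List Config × Config × ℕ × ℕ => p.2.1.2.1.1.isNone :=
    (Primrec.not.comp (Primrec.option_isSome.comp (Primrec.fst.comp hs))).of_eq fun p => by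
      cases p.2.1.2.1.1 <;> rfl
  have h₂ : Primrec fun p : List Config × Config × ℕ × ℕ => p.2.1.2.1.2.isEmpty :=
    (Primrec.not.comp (Primrec.option_isSome.comp (Primrec.list_head?.comp
      (Primrec.snd.comp hs)))).of_eq fun p => by cases p.2.1.2.1.2 <;> rfl
  have h : Primrec₂ fun (_ : List Config) (p : Config × ℕ × ℕ) =>
      bif p.1.2.1.1.isNone && p.1.2.1.2.isEmpty then p.2 else fracAdd p.1.1 p.2 :=
    Primrec.cond (Primrec.and.comp h₁ h₂) (Primrec.snd.comp Primrec.snd) (primrec_fracAdd.comp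
      (Primrec.fst.comp (Primrec.fst.comp Primrec.snd)) (Primrec.snd.comp Primrec.snd))
  exact Primrec.list_foldr Primrec.id (Primrec.const (0, 0)) h

theorem primrec_timeStep : Primrec timeStep :=
  .pair (Primrec.list_flatMap Primrec.fst (Config.primrec_succs.comp Primrec.snd))
    (primrec_fracAdd.comp Primrec.snd (primrec_totalWeight.comp Primrec.fst))

/-! ### Membership in the third level -/

theorem isPi_UPAST : IsPi 3 UPAST := by
  let env : List ℕ → List (ℕ × ℕ × ℕ) := fun ys =>
    Denumerable.ofNat (List (ℕ × ℕ × ℕ)) (ys.getD 0 0)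
  -- The three quantified numbers are the code of the input list, the bound N and the number n of
  -- steps; the default 0 of `getD` never matters for lists of length three.
  let res : Prog × List ℕ → ℕ × ℕ := fun a =>
    (timeStep^[a.2.getD 2 0] (timeInit a.1 (env a.2))).2
  have hy : ∀ i, Primrec fun a : Prog × List ℕ => a.2.getD i 0 := fun i =>
    (Primrec.list_getD 0).comp Primrec.snd (Primrec.const i)
  have hinit : Primrec fun a : Prog × List ℕ => timeInit a.1 (env a.2) :=
    .pair (primrec_list_singleton (.pair (Primrec.const (1, 0))
      (.pair (.pair (Primrec.option_some.comp Primrec.fst) (Primrec.const []))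
        ((Primrec.ofNat _).comp (hy 0))))) (Primrec.const (0, 0))
  have hres : Primrec res := Primrec.snd.comp
    (Primrec.nat_iterate (hy 2) hinit (primrec_timeStep.comp Primrec.snd))
  have hR : PrimrecPred fun a : Prog × List ℕ =>
      (res a).1 ≤ a.2.getD 1 0 * ((res a).2 + 1) :=
    Primrec.nat_le.comp (Primrec.fst.comp hres)
      (Primrec.nat_mul.comp (hy 1) (Primrec.succ.comp (Primrec.snd.comp hres)))
  obtain ⟨hdec, hR⟩ := hR
  refine ⟨_, ⟨hdec, hR.to_comp⟩, fun P => ?_⟩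
  rw [mem_UPAST_iff]
  simp only [sum_survive_le_iff]
  constructor
  · intro h y₁
    exact h (Denumerable.ofNat (List (ℕ × ℕ × ℕ)) y₁)
  · intro h e
    have h' := h (Encodable.encode e)
    change ∃ N : ℕ, ∀ n : ℕ, (timeStep^[n] (timeInit P (Denumerable.ofNat (List (ℕ × ℕ × ℕ))
      (Encodable.encode e)))).2.1 ≤ N * ((timeStep^[n] (timeInit P (Denumerable.ofNat
        (List (ℕ × ℕ × ℕ)) (Encodable.encode e)))).2.2 + 1) at h'
    rwa [Denumerable.ofNat_encode] at h'

end PGCL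

theorem mainTheorem4 : PGCL.IsPiComplete 3 PGCL.UPAST :=
  ⟨PGCL.isPi_UPAST, PGCL.isPiHard_UPAST⟩
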